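/- For a vector field $v$ on $\mathbb R^3$ write, off the axis $r=0$, $v=v_re_r+v_\theta e_\theta+v_ze_z$, where $r=\sqrt{x_1^2+x_2^2}$, $z=x_3$, $e_r=(x_1/r,x_2/r,0)$, $e_\theta=(-x_2/r,x_1/r,0)$, $e_z=(0,0,1)$; $v$ is axially symmetric if $v_r,v_\theta,v_z$ depend only on $(r,z)$. Let $\beta>1$, $C_0\in\mathbb R$, $D\ge 0$, and put, for $r>1$, $$\Phi_\beta(r)=\begin{cases}(1+r)^{-\frac32+\frac1{2(\beta-1)}},&\beta>2,\\ (1+r)^{-1}\ln(1+r),&\beta=2,\\ (1+r)^{1-\beta},&1<\beta<2.\end{cases}$$ There is a constant $C$, depending only on $\beta$, $C_0$ and $D$, such that the following holds for every smooth axially symmetric vector field $u:\mathbb R^3\to\mathbb R^3$ and smooth $p:\mathbb R^3\to\mathbb R$ that solve the stationary Navier–Stokes equations $$-\Delta u+u\cdot\nabla u=-\nabla p,\qquad \nabla\cdot u=0\qquad\text{in }\mathbb R^3,$$ with $u(x)\to0$ as $|x|\to\infty$ and $\int_{\mathbb R^3}|\nabla u|^2\,dx\le D$. Let $w=\nabla\times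 u$. (1) If $|w_\theta|\le C_0r^{-\beta}$ for all $r>0$ and $z\in\mathbb R$, then $|u_r(r,z)|+|u_z(r,z)|\le C\,\Phi_\beta(r)$ for all $r>1$ and $z\in\mathbb R$. (2) If $|w_r|+|w_z|\le C_0r^{-\beta}$ for all $r>0$ and $z\in\mathbb R$, then $|u_\theta(r,z)|\le C\,\Phi_\beta(r)$ for all $r>1$ and $z\in\mathbb R$. -/

import Mathlib

open scoped ContDiff NNReal ENNReal

noncomputable section

namespace AxiNS

/-- Euclidean three-space. -/
abbrev E3 : Type := EuclideanSpace ℝ (Fin 3)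

/-- The partial derivative `∂ⱼ f (x)`. -/
def pd {F : Type*} [NormedAddCommGroup F] [NormedSpace ℝ F] (j : Fin 3) (f : E3 → F) (x : E3) : F :=
  fderiv ℝ f x (EuclideanSpace.single j 1)

/-- The divergence `∑ⱼ ∂ⱼ uⱼ`. -/
def divergence (u : E3 → E3) (x : E3) : ℝ := ∑ j, pd j u x j

/-- The vorticity `w = ∇ × u`. -/
def curl (u : E3 → E3) (x : E3) : E3 :=
  !₂[pd 1 u x 2 - pd 2 u x 1, pd 2 u x 0 - pd 0 u x 2, pd 0 u x 1 - pd 1 u x 0]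

/-- The Dirichlet energy `D(u) = ∫ |∇u|² dx`, where `|∇u|² = ∑ⱼ |∂ⱼ u|²`, as an extended
nonnegative number. -/
def dirichletEnergy (u : E3 → E3) : ℝ≥0∞ :=
  ∫⁻ x, ENNReal.ofReal (∑ j, ‖pd j u x‖ ^ 2)

/-- Distance to the axis, `r = √(x₁² + x₂²)`. -/
def rad (x : E3) : ℝ := √(x 0 ^ 2 + x 1 ^ 2)

/-- `e_r = (x₁/r, x₂/r, 0)` (used off the axis). -/
def er (x : E3) : E3 := !₂[x 0 / rad x, x 1 / rad x, 0]

/-- `e_θ = (-x₂/r, x₁/r, 0)` (used off the axis). -/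
def eθ (x : E3) : E3 := !₂[-(x 1) / rad x, x 0 / rad x, 0]

/-- `e_z = (0, 0, 1)`. -/
def ez : E3 := !₂[0, 0, 1]

/-- The cylindrical component `v_r = v · e_r` of a vector field `v`. -/
def compR (v : E3 → E3) (x : E3) : ℝ := inner ℝ (v x) (er x)

/-- The cylindrical component `v_θ = v · e_θ` of a vector field `v`. -/
def compθ (v : E3 → E3) (x : E3) : ℝ := inner ℝ (v x) (eθ x)

/-- The cylindrical component `v_z = v · e_z` of a vector field `v`. -/
def compZ (v : E3 → E3) (x : E3) : ℝ := inner ℝ (v x) ez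

/-- Axial symmetry: off the axis, `u = u_r(r,z) e_r + u_θ(r,z) e_θ + u_z(r,z) e_z`, with
coefficients that do not depend on the angle. -/
def IsAxisymmetric (u : E3 → E3) : Prop :=
  ∃ ur uθ uz : ℝ → ℝ → ℝ, ∀ x : E3, 0 < rad x →
    u x = ur (rad x) (x 2) • er x + uθ (rad x) (x 2) • eθ x + uz (rad x) (x 2) • ez

/-- `(u, p)` is a smooth, axially symmetric solution in the whole space of the stationary
Navier-Stokes equations `-Δu + u·∇u = -∇p`, `∇·u = 0`, with `u → 0` at infinity. -/
structure IsAxisymmetricSolution (u : E3 → E3) (p : E3 → ℝ) : Prop where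
  smooth_velocity : ContDiff ℝ ∞ u
  smooth_pressure : ContDiff ℝ ∞ p
  axisymmetric : IsAxisymmetric u
  momentum : ∀ x, -Laplacian.laplacian u x + fderiv ℝ u x (u x) = -gradient p x
  incompressible : ∀ x, divergence u x = 0
  vanishing : Filter.Tendsto u (Filter.cocompact E3) (nhds 0)

/-- The decay profile attached to the exponent `β > 1`. -/
def decayRate (β r : ℝ) : ℝ :=
  if 2 < β then (1 + r) ^ (-(3 / 2) + 1 / (2 * (β - 1)))
  else if β = 2 then (1 + r)⁻¹ * Real.log (1 + r)
  else (1 + r) ^ (1 - β)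

end AxiNS

end

namespace AxiNS

open MeasureTheory Filter Topology

/-! The proof is a Biot-Savart estimate applied separately to the meridional and azimuthal parts of
`u`.

Biot-Savart (`norm_le_lintegral_curl`): a divergence free field vanishing at infinity satisfies
|v(x)| ≤ A ∫ |y - x|⁻² |curl v(y)| dy. To see this at the origin, cut `v` off at radius R and test
its Jacobian against a smooth curl free approximation of y/|y|³. The divergence of this kernel is an
approximate identity, and integration by parts leaves only curl and divergence of the cut-off field.
The cutoff error is of size R⁻¹ · R⁻² · R³ · sup |v| over R ≤ |y| ≤ 2R, so v → 0 suffices, without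
any rate.

Symmetry (`symPart_eq`, `curl_symPart`): for an axisymmetric field all reflections across planes
through the axis give the same reflected field Pu. The two parts are therefore (u ± Pu)/2, smooth
also on the axis. Curl anticommutes with P, so the meridional part of `u` has the azimuthal part of
the vorticity as its curl, and conversely. Each hypothesis thus bounds the whole curl of the part to
be estimated.

Decay (`lintegral_potential_le`, `exists_splitting_radius`): for x at distance r from the axis,
split the sources by their own distance s to the axis. For s ≤ ρ, the Dirichlet bound and Young's
inequality give ρ r^(-3/2). For ρ < s ≤ r/2, integrating the kernel along z gives r⁻¹ ∫ s^(1-β) ds.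
For s > r/2, scaling gives r^(1-β). Choosing ρ according to β produces the three regimes of the
profile. -/

/-! ### A smooth curl free kernel approximating y/|y|³. -/

/-- The square of a dilated Japanese bracket, `1 + c² |y|²`. -/
noncomputable def bracketSq (c : ℝ) (y : E3) : ℝ := 1 + c ^ 2 * ‖y‖ ^ 2

/-- The components of `c³ y (1 + c² |y|²)^(-3/2)`, a smooth approximation of `y / |y|³`. -/
noncomputable def regKernel (c : ℝ) (j : Fin 3) (y : E3) : ℝ :=
  c ^ 3 * (y j * bracketSq c y ^ (-(3 / 2) : ℝ))

lemma bracketSq_pos (c : ℝ) (y : E3) : 0 < bracketSq c y := by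
  unfold bracketSq; positivity

lemma contDiff_bracketSq (c : ℝ) : ContDiff ℝ 1 (bracketSq c) := by
  unfold bracketSq
  exact contDiff_const.add (contDiff_const.mul (contDiff_norm_sq ℝ))

lemma contDiff_coord (j : Fin 3) {n : WithTop ℕ∞} : ContDiff ℝ n (fun y : E3 => y j) :=
  (EuclideanSpace.proj j : E3 →L[ℝ] ℝ).contDiff

lemma contDiff_regKernel (c : ℝ) (j : Fin 3) : ContDiff ℝ 1 (regKernel c j) := by
  unfold regKernel
  exact contDiff_const.mul ((contDiff_coord j).mul
    ((contDiff_bracketSq c).rpow_const_of_ne fun y => (bracketSq_pos c y).ne'))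

lemma pd_regKernel (c : ℝ) (i j : Fin 3) (y : E3) :
    pd i (regKernel c j) y = c ^ 3 * ((if i = j then 1 else 0) * bracketSq c y ^ (-(3 / 2) : ℝ)
      - 3 * c ^ 2 * y i * y j * bracketSq c y ^ (-(5 / 2) : ℝ)) := by
  have hq : HasFDerivAt (bracketSq c) (c ^ 2 • (2 • innerSL ℝ y)) y := by
    unfold bracketSq
    exact ((hasStrictFDerivAt_norm_sq y).hasFDerivAt.const_mul (c ^ 2)).const_add 1
  have hr := hq.rpow_const (p := (-(3 / 2) : ℝ)) (Or.inl (bracketSq_pos c y).ne')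
  have hp : HasFDerivAt (fun y : E3 => y j)
      (EuclideanSpace.proj j : E3 →L[ℝ] ℝ) y :=
    (EuclideanSpace.proj j : E3 →L[ℝ] ℝ).hasFDerivAt
  have hK : HasFDerivAt (regKernel c j) _ y := (hp.mul hr).const_mul (c ^ 3)
  unfold pd
  rw [hK.fderiv]
  have h5 : (-(3 / 2) - 1 : ℝ) = -(5 / 2) := by norm_num
  simp [h5, EuclideanSpace.inner_single_right]
  by_cases h : i = j
  · subst h; simp; ring
  · simp only [h, Ne.symm h, if_false, add_zero]; ring

/-- The kernel is the gradient of -c (1 + c²|y|²)^(-1/2), so its Jacobian is a Hessian. -/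
lemma pd_regKernel_symm (c : ℝ) (i j : Fin 3) (y : E3) :
    pd i (regKernel c j) y = pd j (regKernel c i) y := by
  rw [pd_regKernel, pd_regKernel]
  simp only [eq_comm (a := i) (b := j)]
  ring

/-- The |y|² terms cancel, leaving the dilation c³ψ(cy) of the integrable profile ψ = 3(1 +
|y|²)^(-5/2): an approximate identity, up to its mass, as c → ∞. -/
lemma sum_pd_regKernel (c : ℝ) (y : E3) :
    ∑ j, pd j (regKernel c j) y = c ^ 3 * (3 * bracketSq c y ^ (-(5 / 2) : ℝ)) := by
  simp only [pd_regKernel, if_true]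
  have h : bracketSq c y ^ (-(3 / 2) : ℝ)
      = bracketSq c y * bracketSq c y ^ (-(5 / 2) : ℝ) := by
    rw [← Real.rpow_one_add' (bracketSq_pos c y).le (by norm_num)]; norm_num
  rw [h, Fin.sum_univ_three]
  unfold bracketSq
  rw [EuclideanSpace.norm_sq_eq, Fin.sum_univ_three]
  simp only [Real.norm_eq_abs, sq_abs]
  ring

/-- The bound does not depend on c, which is what lets the limit c → ∞ be taken in the final
inequality. -/
lemma abs_regKernel_le {c : ℝ} (hc : 0 < c) (j : Fin 3) (y : E3) :
    |regKernel c j y| ≤ (‖y‖ ^ 2)⁻¹ := by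
  rcases eq_or_ne y 0 with rfl | hy
  · simp [regKernel]
  have hn : 0 < ‖y‖ := norm_pos_iff.mpr hy
  have h1 : bracketSq c y ^ (-(3 / 2) : ℝ) ≤ (c ^ 3 * ‖y‖ ^ 3)⁻¹ := by
    have h2 : ((c * ‖y‖) ^ 2) ^ (-(3 / 2) : ℝ) = (c ^ 3 * ‖y‖ ^ 3)⁻¹ := by
      rw [← Real.rpow_natCast, ← Real.rpow_mul (by positivity), ← mul_pow, ← Real.rpow_natCast,
        ← Real.rpow_neg (by positivity)]
      norm_num
    rw [← h2]
    apply Real.rpow_le_rpow_of_nonpos (by positivity) _ (by norm_num)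
    unfold bracketSq; nlinarith
  have h3 : |y j| ≤ ‖y‖ := by simpa using PiLp.norm_apply_le y j
  have h4 := (Real.rpow_pos_of_pos (bracketSq_pos c y) (-(3 / 2))).le
  unfold regKernel
  rw [abs_mul, abs_mul, abs_of_pos (pow_pos hc 3),
    abs_of_pos (Real.rpow_pos_of_pos (bracketSq_pos c y) _)]
  calc c ^ 3 * (|y j| * bracketSq c y ^ (-(3 / 2) : ℝ))
      ≤ c ^ 3 * (‖y‖ * (c ^ 3 * ‖y‖ ^ 3)⁻¹) := by gcongr
    _ = (‖y‖ ^ 2)⁻¹ := by field_simp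

/-! ### Integration by parts and the limit of the regularized kernel. -/

lemma continuous_pd {F : Type*} [NormedAddCommGroup F] [NormedSpace ℝ F] {f : E3 → F}
    (hf : ContDiff ℝ 1 f) (j : Fin 3) : Continuous (pd j f) := by
  unfold pd
  exact (hf.continuous_fderiv (by norm_num)).clm_apply continuous_const

lemma hasCompactSupport_pd {F : Type*} [NormedAddCommGroup F] [NormedSpace ℝ F] {f : E3 → F}
    (hf : HasCompactSupport f) (j : Fin 3) : HasCompactSupport (pd j f) :=
  hf.fderiv_apply (𝕜 := ℝ) (v := EuclideanSpace.single j 1)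

lemma integral_mul_pd {K f : E3 → ℝ} (hK : ContDiff ℝ 1 K) (hf : ContDiff ℝ 1 f)
    (hc : HasCompactSupport f) (j : Fin 3) :
    ∫ y, K y * pd j f y = -∫ y, pd j K y * f y := by
  refine integral_mul_fderiv_eq_neg_fderiv_mul_of_integrable ?_ ?_ ?_
    (fun x _ => (hK.differentiable (by norm_num)).differentiableAt)
    (fun x _ => (hf.differentiable (by norm_num)).differentiableAt)
  · exact ((continuous_pd hK j).mul hf.continuous).integrable_of_hasCompactSupport hc.mul_left
  · exact (hK.continuous.mul (continuous_pd hf j)).integrable_of_hasCompactSupport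
      (hasCompactSupport_pd hc j).mul_left
  · exact (hK.continuous.mul hf.continuous).integrable_of_hasCompactSupport hc.mul_left

lemma pd_coord {V : E3 → E3} {y : E3} (hV : DifferentiableAt ℝ V y) (i j : Fin 3) :
    pd j (fun x => V x i) y = pd j V y i := by
  have h := (EuclideanSpace.proj i : E3 →L[ℝ] ℝ).hasFDerivAt.comp y
    hV.hasFDerivAt
  have h' : HasFDerivAt (fun x => V x i) _ y := h
  unfold pd
  rw [h'.fderiv]; simp

lemma abs_apply_le (v : E3) (i : Fin 3) : |v i| ≤ ‖v‖ := by
  simpa using PiLp.norm_apply_le v i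

/-- The antisymmetric part of the Jacobian has, up to sign, only entries of the curl and zeros. -/
lemma abs_pd_sub_pd_le_curl (V : E3 → E3) (y : E3) (i j : Fin 3) :
    |pd j V y i - pd i V y j| ≤ ‖curl V y‖ := by
  have h0 := abs_apply_le (curl V y) 0
  have h1 := abs_apply_le (curl V y) 1
  have h2 := abs_apply_le (curl V y) 2
  have hn := norm_nonneg (curl V y)
  simp only [curl, PiLp.toLp_apply, Matrix.cons_val_zero, Matrix.cons_val_one,
    Matrix.cons_val] at h0 h1 h2
  fin_cases i <;> fin_cases j <;> simp <;>
    first | exact hn | assumption | (rw [abs_sub_comm]; assumption)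

/-- The gradient part of a compactly supported field is tested against a curl free kernel. -/
lemma integral_regKernel_identity (c : ℝ) {V : E3 → E3} (hV : ContDiff ℝ 1 V)
    (hc : HasCompactSupport V) (i : Fin 3) :
    ∫ y, c ^ 3 * (3 * bracketSq c y ^ (-(5 / 2) : ℝ)) * V y i
      = -∫ y, ((∑ j, regKernel c j y * (pd j V y i - pd i V y j))
          + regKernel c i y * divergence V y) := by
  have hd : Differentiable ℝ V := hV.differentiable (by norm_num)
  have hVi : ∀ i, ContDiff ℝ 1 (fun x => V x i) := fun i => (contDiff_coord i).comp hV
  have hci : ∀ i, HasCompactSupport (fun x => V x i) := fun i =>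
    hc.comp_left (g := fun v : E3 => v i) rfl
  have hpd : ∀ i j, pd j (fun x => V x i) = fun y => pd j V y i := fun i j =>
    funext fun y => pd_coord (hd y) i j
  have hI : ∀ k i j, Integrable (fun y => regKernel c k y * pd j V y i) := fun k i j => by
    have := ((contDiff_regKernel c k).continuous.mul
      (continuous_pd (hVi i) j)).integrable_of_hasCompactSupport (μ := volume)
      (hasCompactSupport_pd (hci i) j).mul_left
    rwa [hpd] at this
  have hI' : ∀ k i j, Integrable (fun y => pd j (regKernel c k) y * V y i) := fun k i j =>
    ((continuous_pd (contDiff_regKernel c k) j).mul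
      (hVi i).continuous).integrable_of_hasCompactSupport (hci i).mul_left
  have hP : ∀ k i j, ∫ y, regKernel c k y * pd j V y i = -∫ y, pd j (regKernel c k) y * V y i :=
    fun k i j => by
      have := integral_mul_pd (contDiff_regKernel c k) (hVi i) (hci i) j
      rwa [hpd] at this
  -- Two integrations by parts and the symmetry of the kernel's Jacobian exchange the indices;
  -- summed over j, the right side becomes the divergence of V against the kernel.
  have hswap : ∀ j, ∫ y, regKernel c j y * pd i V y j = ∫ y, regKernel c i y * pd j V y j := by
    intro j
    rw [hP, hP]
    simp only [pd_regKernel_symm c i j]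
  have hL : ∫ y, c ^ 3 * (3 * bracketSq c y ^ (-(5 / 2) : ℝ)) * V y i
      = -∑ j, ∫ y, regKernel c j y * pd j V y i := by
    simp only [hP, Finset.sum_neg_distrib, neg_neg]
    rw [← integral_finsetSum _ fun j _ => hI' j i j]
    simp only [← sum_pd_regKernel, Finset.sum_mul]
  rw [hL, integral_add]
  · rw [integral_finsetSum]
    · simp only [divergence, Finset.mul_sum, mul_sub]
      rw [integral_finsetSum _ fun j _ => hI i j j]
      simp only [integral_sub (hI _ i _) (hI _ _ i), Finset.sum_sub_distrib, hswap]
      ring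
    · intro j _
      simp only [mul_sub]
      exact (hI _ _ _).sub (hI _ _ _)
  · simp only [mul_sub]
    exact integrable_finsetSum _ fun j _ => (hI _ _ _).sub (hI _ _ _)
  · simp only [divergence, Finset.mul_sum]
    exact integrable_finsetSum _ fun j _ => hI _ _ _

lemma enorm_integral_regKernel_le {c : ℝ} (hpos : 0 < c) {V : E3 → E3} (hV : ContDiff ℝ 1 V)
    (hc : HasCompactSupport V) (i : Fin 3) :
    ‖∫ y, c ^ 3 * (3 * bracketSq c y ^ (-(5 / 2) : ℝ)) * V y i‖ₑ
      ≤ ∫⁻ y, ENNReal.ofReal ((‖y‖ ^ 2)⁻¹ * (3 * ‖curl V y‖ + |divergence V y|)) := by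
  rw [integral_regKernel_identity c hV hc, enorm_neg]
  refine (enorm_integral_le_lintegral_enorm _).trans (lintegral_mono fun y => ?_)
  rw [← ofReal_norm]
  apply ENNReal.ofReal_le_ofReal
  rw [Real.norm_eq_abs]
  refine (abs_add_le _ _).trans ?_
  rw [mul_add]
  refine add_le_add ((Finset.abs_sum_le_sum_abs _ _).trans ?_) ?_
  · calc ∑ j, |regKernel c j y * (pd j V y i - pd i V y j)|
        ≤ ∑ _j : Fin 3, (‖y‖ ^ 2)⁻¹ * ‖curl V y‖ := by
          refine Finset.sum_le_sum fun j _ => ?_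
          rw [abs_mul]
          exact mul_le_mul (abs_regKernel_le hpos j y) (abs_pd_sub_pd_le_curl V y i j)
            (abs_nonneg _) (by positivity)
      _ = (‖y‖ ^ 2)⁻¹ * (3 * ‖curl V y‖) := by simp; ring
  · rw [abs_mul]
    exact mul_le_mul_of_nonneg_right (abs_regKernel_le hpos i y) (abs_nonneg _)

lemma integrable_bracketSq : Integrable (fun y : E3 => 3 * bracketSq 1 y ^ (-(5 / 2) : ℝ)) := by
  have := integrable_rpow_neg_one_add_norm_sq (E := E3) (μ := volume) (r := 5)
    (by simp; norm_num)
  simpa [bracketSq, neg_div] using this.const_mul 3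

lemma integral_bracketSq_pos : 0 < ∫ y : E3, 3 * bracketSq 1 y ^ (-(5 / 2) : ℝ) := by
  rw [integral_pos_iff_support_of_nonneg (fun y => by
    have := bracketSq_pos 1 y; positivity) integrable_bracketSq]
  have : Function.support (fun y : E3 => 3 * bracketSq 1 y ^ (-(5 / 2) : ℝ)) = Set.univ := by
    ext y
    have := Real.rpow_pos_of_pos (bracketSq_pos 1 y) (-(5 / 2))
    simp [this.ne']
  rw [this]; simp

/-- Convergence of an approximate identity at a point of continuity, with the mass κ of the profile
divided out and restored afterwards. -/
lemma tendsto_regKernel {V : E3 → E3} (hV : ContDiff ℝ 1 V) (hc : HasCompactSupport V)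
    (i : Fin 3) :
    Tendsto (fun c : ℝ => ∫ y, c ^ 3 * (3 * bracketSq c y ^ (-(5 / 2) : ℝ)) * V y i) atTop
      (𝓝 ((∫ y : E3, 3 * bracketSq 1 y ^ (-(5 / 2) : ℝ)) * V 0 i)) := by
  have hκ0 : 0 < ∫ y : E3, 3 * bracketSq 1 y ^ (-(5 / 2) : ℝ) := integral_bracketSq_pos
  generalize hκ : ∫ y : E3, 3 * bracketSq 1 y ^ (-(5 / 2) : ℝ) = κ at hκ0 ⊢
  have hcont : Continuous fun y => V y i := ((contDiff_coord i).comp hV).continuous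
  have hint : Integrable fun y => V y i := hcont.integrable_of_hasCompactSupport
    (hc.comp_left (g := fun v : E3 => v i) rfl)
  -- The profile is O(|y|⁻⁵), so its product with |y|³ is O(|y|⁻²).
  have hdec : Tendsto (fun y : E3 => ‖y‖ ^ Module.finrank ℝ E3 *
      (κ⁻¹ * (3 * bracketSq 1 y ^ (-(5 / 2) : ℝ)))) (Bornology.cobounded E3) (𝓝 0) := by
    have h1 : Tendsto (fun y : E3 => κ⁻¹ * 3 * ‖y‖ ^ (-2 : ℝ)) (Bornology.cobounded E3) (𝓝 0) := by
      have := ((tendsto_rpow_neg_atTop (y := 2) (by norm_num)).comp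
        (tendsto_norm_cobounded_atTop (E := E3))).const_mul (κ⁻¹ * 3)
      rw [mul_zero] at this
      exact this
    refine squeeze_zero' (Eventually.of_forall fun y => ?_) ?_ h1
    · exact mul_nonneg (by positivity) (mul_nonneg (by positivity)
        (mul_nonneg (by norm_num) (Real.rpow_nonneg (bracketSq_pos 1 y).le _)))
    · filter_upwards [(tendsto_norm_cobounded_atTop (E := E3)).eventually_gt_atTop 0] with y hy
      have h2 : bracketSq 1 y ^ (-(5 / 2) : ℝ) ≤ ‖y‖ ^ (-5 : ℝ) := by
        have h3 : (‖y‖ ^ 2) ^ (-(5 / 2) : ℝ) = ‖y‖ ^ (-5 : ℝ) := by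
          rw [← Real.rpow_natCast, ← Real.rpow_mul (by positivity)]; norm_num
        rw [← h3]
        apply Real.rpow_le_rpow_of_nonpos (by positivity) _ (by norm_num)
        unfold bracketSq; nlinarith
      have h4 : ‖y‖ ^ (-2 : ℝ) = ‖y‖ ^ 3 * ‖y‖ ^ (-5 : ℝ) := by
        rw [← Real.rpow_natCast, ← Real.rpow_add hy]; norm_num
      rw [h4]
      have hf : Module.finrank ℝ E3 = 3 := by simp
      rw [hf]
      calc ‖y‖ ^ 3 * (κ⁻¹ * (3 * bracketSq 1 y ^ (-(5 / 2) : ℝ)))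
          ≤ ‖y‖ ^ 3 * (κ⁻¹ * (3 * ‖y‖ ^ (-5 : ℝ))) := by gcongr
        _ = _ := by ring
  have key := tendsto_integral_comp_smul_smul_of_integrable (F := E3) (E := ℝ) (μ := volume)
    (φ := fun y => κ⁻¹ * (3 * bracketSq 1 y ^ (-(5 / 2) : ℝ)))
    (fun y => mul_nonneg (inv_pos.mpr hκ0).le
      (mul_nonneg (by norm_num) (Real.rpow_nonneg (bracketSq_pos 1 y).le _)))
    (by rw [integral_const_mul, hκ, inv_mul_cancel₀ hκ0.ne']) hdec hint hcont.continuousAt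
  have := key.const_mul κ
  refine this.congr fun c => ?_
  rw [← integral_const_mul]
  congr 1; ext y
  have hb : bracketSq 1 (c • y) = bracketSq c y := by
    simp [bracketSq, norm_smul, mul_pow]
  simp only [hb, smul_eq_mul, finrank_euclideanSpace, Fintype.card_fin]
  field_simp

/-! ### The Biot-Savart bound. -/

lemma norm_le_sum_abs (v : E3) : ‖v‖ ≤ |v 0| + |v 1| + |v 2| := by
  rw [EuclideanSpace.norm_eq, Fin.sum_univ_three]
  apply Real.sqrt_le_iff.mpr
  have h0 := abs_nonneg (v 0)
  have h1 := abs_nonneg (v 1)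
  have h2 := abs_nonneg (v 2)
  simp only [Real.norm_eq_abs]
  constructor
  · positivity
  · nlinarith [mul_nonneg h0 h1, mul_nonneg h0 h2, mul_nonneg h1 h2]

/-- A compactly supported field is controlled by its curl and divergence through the
kernel `|y|⁻²`. -/
theorem norm_le_lintegral_curl_div : ∃ A : ℝ≥0, ∀ V : E3 → E3, ContDiff ℝ 1 V →
    HasCompactSupport V → ‖V 0‖ₑ ≤
      A * ∫⁻ y, ENNReal.ofReal ((‖y‖ ^ 2)⁻¹ * (3 * ‖curl V y‖ + |divergence V y|)) := by
  set κ := ∫ y : E3, 3 * bracketSq 1 y ^ (-(5 / 2) : ℝ) with hκ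
  have hκ0 : 0 < κ := integral_bracketSq_pos
  refine ⟨(3 * κ⁻¹).toNNReal, fun V hV hc => ?_⟩
  set I := ∫⁻ y, ENNReal.ofReal ((‖y‖ ^ 2)⁻¹ * (3 * ‖curl V y‖ + |divergence V y|))
  have hi : ∀ i, ‖V 0 i‖ₑ ≤ ENNReal.ofReal κ⁻¹ * I := by
    intro i
    have h := le_of_tendsto (tendsto_regKernel hV hc i).enorm
      ((eventually_gt_atTop 0).mono fun c hpos => enorm_integral_regKernel_le hpos hV hc i)
    rw [enorm_mul, ← hκ] at h
    have h2 : ‖V 0 i‖ₑ = ENNReal.ofReal κ⁻¹ * (‖κ‖ₑ * ‖V 0 i‖ₑ) := by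
      rw [← mul_assoc, Real.enorm_of_nonneg hκ0.le, ← ENNReal.ofReal_mul (by positivity),
        inv_mul_cancel₀ hκ0.ne']; simp
    rw [h2]
    gcongr
  calc ‖V 0‖ₑ ≤ ‖V 0 0‖ₑ + ‖V 0 1‖ₑ + ‖V 0 2‖ₑ := by
        simp only [← ofReal_norm, Real.norm_eq_abs]
        rw [← ENNReal.ofReal_add (by positivity) (by positivity),
          ← ENNReal.ofReal_add (by positivity) (by positivity)]
        exact ENNReal.ofReal_le_ofReal (norm_le_sum_abs _)
    _ ≤ ENNReal.ofReal κ⁻¹ * I + ENNReal.ofReal κ⁻¹ * I + ENNReal.ofReal κ⁻¹ * I :=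
        add_le_add (add_le_add (hi 0) (hi 1)) (hi 2)
    _ = ENNReal.ofReal (3 * κ⁻¹) * I := by
        rw [ENNReal.ofReal_mul (by norm_num)]; norm_num; ring

/-- Dilations of one fixed bump function, so that M serves every R and the gradient lives on the
shell R ≤ |y| ≤ 2R. -/
lemma exists_cutoff : ∃ M : ℝ, 0 ≤ M ∧ ∀ R : ℝ, 0 < R → ∃ φ : E3 → ℝ, ContDiff ℝ 1 φ ∧
    HasCompactSupport φ ∧ φ 0 = 1 ∧ (∀ y, |φ y| ≤ 1) ∧ (∀ j y, |pd j φ y| ≤ M / R) ∧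
    ∀ j y, ‖y‖ < R ∨ 2 * R < ‖y‖ → pd j φ y = 0 := by
  let χ : ContDiffBump (0 : E3) := ⟨1, 2, by norm_num, by norm_num⟩
  have hχ : ContDiff ℝ 1 χ := χ.contDiff
  have hχc : HasCompactSupport χ := χ.hasCompactSupport
  obtain ⟨M, hM⟩ : ∃ M, ∀ y, ‖fderiv ℝ χ y‖ ≤ M :=
    (hχ.continuous_fderiv (by norm_num)).bounded_above_of_compact_support (hχc.fderiv ℝ)
  have hM0 : 0 ≤ M := (norm_nonneg _).trans (hM 0)
  refine ⟨M, hM0, fun R hR => ⟨fun y => χ ((R⁻¹ : ℝ) • y),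
    hχ.comp (contDiff_id.const_smul (R⁻¹ : ℝ)), ?_, ?_, ?_,
    ?_, ?_⟩⟩
  · exact hχc.comp_homeomorph (Homeomorph.smulOfNeZero R⁻¹ (inv_ne_zero hR.ne'))
  · simp only [smul_zero]; exact χ.one_of_mem_closedBall (by simp [χ])
  · intro y; rw [abs_of_nonneg χ.nonneg]; exact χ.le_one
  · intro j y
    have h : HasFDerivAt (fun y => χ (R⁻¹ • y)) _ y :=
      ((hχ.differentiable (by norm_num)) (R⁻¹ • y)).hasFDerivAt.comp y
        ((hasFDerivAt_id y).const_smul R⁻¹)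
    unfold pd
    rw [h.fderiv]
    simp only [ContinuousLinearMap.comp_apply, _root_.smul_apply,
      ContinuousLinearMap.id_apply, map_smul, smul_eq_mul, abs_mul, abs_inv, abs_of_pos hR]
    rw [div_eq_inv_mul]
    gcongr
    have := (fderiv ℝ χ (R⁻¹ • y)).le_opNorm (EuclideanSpace.single j 1)
    simp only [PiLp.norm_single, norm_one, mul_one, Real.norm_eq_abs] at this
    exact this.trans (hM _)
  · intro j y hy
    have hn : ∀ z : E3, ‖R⁻¹ • z‖ = ‖z‖ / R := fun z => by
      rw [norm_smul, Real.norm_eq_abs, abs_of_pos (inv_pos.mpr hR)]; ring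
    have : ∃ k : ℝ, (fun y => χ (R⁻¹ • y)) =ᶠ[𝓝 y] fun _ => k := by
      rcases hy with hy | hy
      · refine ⟨1, ?_⟩
        filter_upwards [continuous_norm.continuousAt.eventually_lt_const hy] with z hz
        apply χ.one_of_mem_closedBall
        simp only [mem_closedBall_zero_iff, hn, χ]
        exact (div_le_one hR).mpr hz.le
      · refine ⟨0, ?_⟩
        filter_upwards [continuous_norm.continuousAt.eventually_const_lt hy] with z hz
        apply χ.zero_of_le_dist
        simp only [dist_zero_right, hn, χ]
        exact (le_div_iff₀ hR).mpr hz.le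
    obtain ⟨k, hk⟩ := this
    unfold pd
    rw [hk.fderiv_eq]; simp

lemma pd_smul {φ : E3 → ℝ} {v : E3 → E3} {y : E3} (hφ : DifferentiableAt ℝ φ y)
    (hv : DifferentiableAt ℝ v y) (j : Fin 3) :
    pd j (fun x => φ x • v x) y = φ y • pd j v y + pd j φ y • v y := by
  unfold pd
  rw [fderiv_fun_smul hφ hv]; simp

lemma norm_curl_smul_le {φ : E3 → ℝ} {v : E3 → E3} {y : E3} (hφ : DifferentiableAt ℝ φ y)
    (hv : DifferentiableAt ℝ v y) {δ : ℝ} (hδ : ∀ j, |pd j φ y| ≤ δ) (h1 : |φ y| ≤ 1) :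
    ‖curl (fun x => φ x • v x) y‖ ≤ ‖curl v y‖ + 6 * δ * ‖v y‖ := by
  have hδ0 : 0 ≤ δ := (abs_nonneg _).trans (hδ 0)
  have heq : curl (fun x => φ x • v x) y = φ y • curl v y +
      !₂[pd 1 φ y * v y 2 - pd 2 φ y * v y 1, pd 2 φ y * v y 0 - pd 0 φ y * v y 2,
        pd 0 φ y * v y 1 - pd 1 φ y * v y 0] := by
    ext i
    fin_cases i <;> simp [curl, pd_smul hφ hv] <;> ring
  have hb : ∀ j k, |pd j φ y * v y k| ≤ δ * ‖v y‖ := fun j k => by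
    rw [abs_mul]; exact mul_le_mul (hδ j) (abs_apply_le _ _) (abs_nonneg _) hδ0
  have hs : ∀ a b c d, |pd a φ y * v y b - pd c φ y * v y d| ≤ 2 * (δ * ‖v y‖) := fun a b c d =>
    (abs_sub _ _).trans (by linarith [hb a b, hb c d])
  rw [heq]
  refine (norm_add_le _ _).trans (add_le_add ?_ ((norm_le_sum_abs _).trans ?_))
  · rw [norm_smul, Real.norm_eq_abs]; exact mul_le_of_le_one_left (norm_nonneg _) h1
  · simp only [Matrix.cons_val_zero, Matrix.cons_val_one, Matrix.cons_val]
    linarith [hs 1 2 2 1, hs 2 0 0 2, hs 0 1 1 0]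

lemma abs_divergence_smul_le {φ : E3 → ℝ} {v : E3 → E3} {y : E3} (hφ : DifferentiableAt ℝ φ y)
    (hv : DifferentiableAt ℝ v y) {δ : ℝ} (hδ : ∀ j, |pd j φ y| ≤ δ) (hd : divergence v y = 0) :
    |divergence (fun x => φ x • v x) y| ≤ 3 * δ * ‖v y‖ := by
  have hδ0 : 0 ≤ δ := (abs_nonneg _).trans (hδ 0)
  have heq : divergence (fun x => φ x • v x) y = ∑ j, pd j φ y * v y j := by
    have : divergence (fun x => φ x • v x) y = φ y * divergence v y + ∑ j, pd j φ y * v y j := by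
      simp [divergence, pd_smul hφ hv, Finset.sum_add_distrib, Finset.mul_sum]
    rw [this, hd]; ring
  rw [heq]
  refine (Finset.abs_sum_le_sum_abs _ _).trans ?_
  calc ∑ j, |pd j φ y * v y j| ≤ ∑ _j : Fin 3, δ * ‖v y‖ := by
        refine Finset.sum_le_sum fun j _ => ?_
        rw [abs_mul]; exact mul_le_mul (hδ j) (abs_apply_le _ _) (abs_nonneg _) hδ0
    _ = 3 * δ * ‖v y‖ := by simp; ring

/-- A divergence free field vanishing at infinity is controlled at the origin by its curl
through the kernel `|y|⁻²`. -/
lemma norm_zero_le_lintegral_curl : ∃ A : ℝ≥0, ∀ v : E3 → E3, ContDiff ℝ 1 v →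
    (∀ y, divergence v y = 0) → Tendsto v (cocompact E3) (𝓝 0) →
    ‖v 0‖ₑ ≤ A * ∫⁻ y, ENNReal.ofReal ((‖y‖ ^ 2)⁻¹ * ‖curl v y‖) := by
  obtain ⟨A, hA⟩ := norm_le_lintegral_curl_div
  obtain ⟨M, hM0, hM⟩ := exists_cutoff
  refine ⟨A * 3, fun v hv hdiv hlim => ?_⟩
  set I := ∫⁻ y, ENNReal.ofReal ((‖y‖ ^ 2)⁻¹ * ‖curl v y‖)
  have hvd : Differentiable ℝ v := hv.differentiable (by norm_num)
  -- Here 21 = 3 · 6 + 3 collects the commutator constants of curl and divergence, and 8 = 2³ comes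
  -- from the volume of the ball of radius 2R. The powers R⁻², R⁻¹ and R³ cancel, so the cutoff
  -- error is B times a bound η for |v| on the shell.
  set B : ℝ≥0∞ := A * (ENNReal.ofReal (21 * M * 8) * volume (Metric.ball (0 : E3) 1)) with hB
  have hBtop : B ≠ ⊤ := by
    refine ENNReal.mul_ne_top ENNReal.coe_ne_top (ENNReal.mul_ne_top ENNReal.ofReal_ne_top ?_)
    exact measure_ball_lt_top.ne
  have key : ∀ η : ℝ, 0 < η → ‖v 0‖ₑ ≤ (A * 3 : ℝ≥0) * I + B * ENNReal.ofReal η := by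
    intro η hη
    obtain ⟨R, hR, hvR⟩ : ∃ R : ℝ, 0 < R ∧ ∀ y, R ≤ ‖y‖ → ‖v y‖ ≤ η := by
      have h1 := (hlim.norm).eventually_le_const (by simpa using hη)
      rw [← Metric.cobounded_eq_cocompact, ← comap_norm_atTop, eventually_comap] at h1
      obtain ⟨R, hR⟩ := eventually_atTop.mp h1
      exact ⟨max R 1, by positivity, fun y hy => hR _ (le_of_max_le_left hy) y rfl⟩
    obtain ⟨φ, hφ, hφc, hφ0, hφ1, hφM, hφz⟩ := hM R hR
    have hφd : Differentiable ℝ φ := hφ.differentiable (by norm_num)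
    have h := hA (fun y => φ y • v y) (hφ.smul hv) (hφc.smul_right)
    simp only [hφ0, one_smul] at h
    have hpt : ∀ y, ENNReal.ofReal ((‖y‖ ^ 2)⁻¹ * (3 * ‖curl (fun y => φ y • v y) y‖ +
          |divergence (fun y => φ y • v y) y|))
        ≤ 3 * ENNReal.ofReal ((‖y‖ ^ 2)⁻¹ * ‖curl v y‖) +
          (Metric.closedBall (0 : E3) (2 * R)).indicator
            (fun _ => ENNReal.ofReal ((R ^ 2)⁻¹ * (21 * (M / R) * η))) y := by
      intro y
      have h3 : (3 : ℝ≥0∞) = ENNReal.ofReal 3 := by norm_num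
      by_cases hy : ‖y‖ < R ∨ 2 * R < ‖y‖
      · have hδ : ∀ j, |pd j φ y| ≤ 0 := fun j => by rw [hφz j y hy, abs_zero]
        have hc := norm_curl_smul_le (hφd y) (hvd y) hδ (hφ1 y)
        have hd := abs_divergence_smul_le (hφd y) (hvd y) hδ (hdiv y)
        refine le_trans ?_ le_self_add
        rw [h3, ← ENNReal.ofReal_mul (by norm_num)]
        apply ENNReal.ofReal_le_ofReal
        calc _ ≤ (‖y‖ ^ 2)⁻¹ * (3 * ‖curl v y‖) := by gcongr; linarith
          _ = _ := by ring
      · push Not at hy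
        have hc := norm_curl_smul_le (hφd y) (hvd y) (fun j => hφM j y) (hφ1 y)
        have hd := abs_divergence_smul_le (hφd y) (hvd y) (fun j => hφM j y) (hdiv y)
        rw [Set.indicator_of_mem (by simpa using hy.2), h3, ← ENNReal.ofReal_mul (by norm_num),
          ← ENNReal.ofReal_add (by positivity) (by positivity)]
        apply ENNReal.ofReal_le_ofReal
        have hMR : 0 ≤ M / R := by positivity
        calc _ ≤ (‖y‖ ^ 2)⁻¹ * (3 * ‖curl v y‖ + 21 * (M / R) * ‖v y‖) := by
              refine mul_le_mul_of_nonneg_left ?_ (by positivity)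
              linarith
          _ = 3 * ((‖y‖ ^ 2)⁻¹ * ‖curl v y‖) + (‖y‖ ^ 2)⁻¹ * (21 * (M / R) * ‖v y‖) := by ring
          _ ≤ _ := by
              have := hvR y hy.1
              have := hy.1
              gcongr
    have hvol : ENNReal.ofReal ((R ^ 2)⁻¹ * (21 * (M / R) * η)) *
        volume (Metric.closedBall (0 : E3) (2 * R))
        = ENNReal.ofReal (21 * M * 8) * volume (Metric.ball (0 : E3) 1) * ENNReal.ofReal η := by
      rw [Measure.addHaar_closedBall _ _ (by positivity), mul_right_comm _ _ (ENNReal.ofReal η),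
        ← ENNReal.ofReal_mul (by positivity), ← mul_assoc, ← ENNReal.ofReal_mul (by positivity)]
      congr 2
      simp only [finrank_euclideanSpace, Fintype.card_fin]
      field_simp
      norm_num
    have hint := (lintegral_mono (μ := volume) hpt).trans_eq (lintegral_add_right _
      (measurable_const.indicator Metric.isClosed_closedBall.measurableSet))
    rw [lintegral_const_mul' _ _ (by norm_num),
      lintegral_indicator_const Metric.isClosed_closedBall.measurableSet, hvol] at hint
    calc ‖v 0‖ₑ ≤ _ := h
      _ ≤ A * (3 * I + ENNReal.ofReal (21 * M * 8) * volume (Metric.ball (0 : E3) 1) *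
            ENNReal.ofReal η) := by gcongr
      _ = _ := by rw [hB]; push_cast; ring
  refine ENNReal.le_of_forall_pos_le_add fun ε hε _ => ?_
  obtain ⟨η, hη, hle⟩ : ∃ η : ℝ, 0 < η ∧ B * ENNReal.ofReal η ≤ ε := by
    -- The added 1 covers the case B = 0.
    refine ⟨ε / (B.toReal + 1), by positivity, ?_⟩
    rw [← ENNReal.ofReal_toReal hBtop, ← ENNReal.ofReal_mul ENNReal.toReal_nonneg,
      ← ENNReal.ofReal_coe_nnreal, ENNReal.ofReal_toReal hBtop]
    apply ENNReal.ofReal_le_ofReal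
    rw [mul_div_assoc', div_le_iff₀ (by positivity)]
    nlinarith [ε.2, ENNReal.toReal_nonneg (a := B), NNReal.coe_pos.mpr hε]
  exact (key η hη).trans (by gcongr)

/-- A divergence free field vanishing at infinity is controlled by the Biot-Savart potential of
the modulus of its curl. -/
theorem norm_le_lintegral_curl : ∃ A : ℝ≥0, ∀ v : E3 → E3, ContDiff ℝ 1 v →
    (∀ y, divergence v y = 0) → Tendsto v (cocompact E3) (𝓝 0) → ∀ x,
    ‖v x‖ₑ ≤ A * ∫⁻ y, ENNReal.ofReal ((‖y - x‖ ^ 2)⁻¹ * ‖curl v y‖) := by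
  obtain ⟨A, hA⟩ := norm_zero_le_lintegral_curl
  refine ⟨A, fun v hv hdiv hlim x => ?_⟩
  have hpd : ∀ j y, pd j (fun y => v (y + x)) y = pd j v (y + x) := fun j y => by
    unfold pd; rw [fderiv_comp_add_right]
  have hcurl : ∀ y, curl (fun y => v (y + x)) y = curl v (y + x) := fun y => by
    simp only [curl, hpd]
  have h := hA (fun y => v (y + x)) (hv.comp (contDiff_id.add contDiff_const))
    (fun y => by simpa only [divergence, hpd] using hdiv (y + x))
    (hlim.comp (Homeomorph.addRight x).isClosedEmbedding.tendsto_cocompact)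
  simp only [hcurl, zero_add] at h
  rw [← lintegral_add_right_eq_self (fun y => ENNReal.ofReal ((‖y - x‖ ^ 2)⁻¹ * ‖curl v y‖)) x]
  simpa using h

/-! ### Integration along the axis and in polar coordinates. -/

lemma lintegral_euclideanSpace_three {f : ℝ → ℝ → ℝ → ℝ≥0∞}
    (hf : Measurable fun q : (ℝ × ℝ) × ℝ => f q.1.1 q.1.2 q.2) :
    ∫⁻ y : E3, f (y 0) (y 1) (y 2) = ∫⁻ p : ℝ × ℝ, ∫⁻ z, f p.1 p.2 z := by
  rw [← lintegral_prod (fun q : (ℝ × ℝ) × ℝ => f q.1.1 q.1.2 q.2) hf.aemeasurable]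
  have h1 := EuclideanSpace.volume_preserving_symm_measurableEquiv_toLp (Fin 3)
  have h2 := volume_preserving_piFinSuccAbove (fun _ : Fin 3 => ℝ) 2
  have h3 := (MeasurePreserving.id (volume : Measure ℝ)).prod (volume_preserving_finTwoArrow ℝ)
  have h4 := (h3.comp h2).comp h1
  have h5 := (Measure.measurePreserving_swap (μ := (volume : Measure ℝ))
    (ν := (volume : Measure (ℝ × ℝ)))).comp h4
  exact h5.lintegral_comp hf

/-- The Euclidean length of a point of the plane `ℝ × ℝ`. -/
noncomputable def planeNorm (p : ℝ × ℝ) : ℝ := √(p.1 ^ 2 + p.2 ^ 2)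

lemma measurable_planeNorm : Measurable planeNorm := by unfold planeNorm; fun_prop

lemma planeNorm_sq (p : ℝ × ℝ) : planeNorm p ^ 2 = p.1 ^ 2 + p.2 ^ 2 :=
  Real.sq_sqrt (by positivity)

lemma planeNorm_eq_norm (p : ℝ × ℝ) : planeNorm p = ‖(⟨p.1, p.2⟩ : ℂ)‖ := by
  rw [Complex.norm_def, Complex.normSq_mk, planeNorm]; ring_nf

lemma planeNorm_le_add (p q : ℝ × ℝ) : planeNorm q ≤ planeNorm p + planeNorm (p - q) := by
  simp only [planeNorm_eq_norm]
  have := norm_sub_le (⟨p.1, p.2⟩ : ℂ) (⟨(p - q).1, (p - q).2⟩ : ℂ)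
  have h : (⟨q.1, q.2⟩ : ℂ) = ⟨p.1, p.2⟩ - ⟨(p - q).1, (p - q).2⟩ := by
    apply Complex.ext <;> simp
  rwa [h]

lemma ae_planeNorm_pos : ∀ᵐ p : ℝ × ℝ, 0 < planeNorm p := by
  have : ∀ᵐ p : ℝ × ℝ, p ≠ 0 := by simp [ae_iff]
  filter_upwards [this] with p hp
  rw [planeNorm_eq_norm, norm_pos_iff]
  intro h
  exact hp (Prod.ext (congrArg Complex.re h) (congrArg Complex.im h))

lemma ae_planeNorm_sub_pos (q : ℝ × ℝ) : ∀ᵐ p : ℝ × ℝ, 0 < planeNorm (p - q) :=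
  (measurePreserving_sub_right volume q).quasiMeasurePreserving.ae ae_planeNorm_pos

lemma lintegral_planeNorm {F : ℝ → ℝ≥0∞} (hF : Measurable F) :
    ∫⁻ p : ℝ × ℝ, F (planeNorm p)
      = ENNReal.ofReal (2 * Real.pi) * ∫⁻ s in Set.Ioi 0, ENNReal.ofReal s * F s := by
  rw [← lintegral_comp_polarCoord_symm]
  have : ∀ p ∈ polarCoord.target, ENNReal.ofReal p.1 • F (planeNorm (polarCoord.symm p))
      = ENNReal.ofReal p.1 * F p.1 := by
    intro p hp
    simp only [polarCoord_target, Set.mem_prod, Set.mem_Ioi] at hp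
    have : planeNorm (polarCoord.symm p) = p.1 := by
      rw [planeNorm, Real.sqrt_eq_iff_mul_self_eq (by positivity) hp.1.le]
      simp only [polarCoord_symm_apply]
      linear_combination p.1 ^ 2 * Real.sin_sq_add_cos_sq p.2
    rw [this, smul_eq_mul]
  rw [setLIntegral_congr_fun polarCoord.open_target.measurableSet this, polarCoord_target,
    Measure.volume_eq_prod, ← Measure.prod_restrict, lintegral_prod _ (by fun_prop)]
  simp only [lintegral_const, MeasurableSet.univ, Measure.restrict_apply, Set.univ_inter,
    Real.volume_Ioo]
  rw [lintegral_mul_const _ (by fun_prop), mul_comm]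
  congr 2; ring

lemma lintegral_planeNorm_sub (F : ℝ → ℝ≥0∞) (q : ℝ × ℝ) :
    ∫⁻ p : ℝ × ℝ, F (planeNorm (p - q)) = ∫⁻ p : ℝ × ℝ, F (planeNorm p) :=
  lintegral_sub_right_eq_self (fun p => F (planeNorm p)) q

lemma lintegral_inv_sq_add_sq {b : ℝ} (hb : 0 < b) (z₀ : ℝ) :
    ∫⁻ z, ENNReal.ofReal ((b ^ 2 + (z - z₀) ^ 2)⁻¹) = ENNReal.ofReal (Real.pi / b) := by
  rw [lintegral_sub_right_eq_self (fun z => ENNReal.ofReal ((b ^ 2 + z ^ 2)⁻¹)) z₀]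
  have h : ∀ z : ℝ, (b ^ 2 + z ^ 2)⁻¹ = (b ^ 2)⁻¹ * (1 + (b⁻¹ * z) ^ 2)⁻¹ := fun z => by
    rw [← mul_inv]; congr 1; field_simp
  simp only [h]
  rw [← ofReal_integral_eq_lintegral_ofReal
    ((integrable_inv_one_add_sq.comp_mul_left' (inv_ne_zero hb.ne')).const_mul _)
    (Eventually.of_forall fun z => by positivity)]
  rw [integral_const_mul, Measure.integral_comp_mul_left (fun z => (1 + z ^ 2)⁻¹),
    integral_univ_inv_one_add_sq, inv_inv, abs_of_pos hb, smul_eq_mul]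
  congr 1; field_simp

/-- Integration of the kernel `|y - x|⁻²` along the lines parallel to the axis. -/
lemma lintegral_mul_kernel {G : ℝ × ℝ → ℝ≥0∞} (hG : Measurable G) (x : E3) :
    ∫⁻ y : E3, G (y 0, y 1) * ENNReal.ofReal ((‖y - x‖ ^ 2)⁻¹)
      = ∫⁻ p, G p * ENNReal.ofReal (Real.pi / planeNorm (p - (x 0, x 1))) := by
  have h : ∀ y : E3, ‖y - x‖ ^ 2
      = planeNorm ((y 0, y 1) - (x 0, x 1)) ^ 2 + (y 2 - x 2) ^ 2 := fun y => by
    rw [EuclideanSpace.norm_sq_eq, Fin.sum_univ_three, planeNorm_sq]; simp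
  simp only [h]
  have hm := measurable_planeNorm
  rw [lintegral_euclideanSpace_three (f := fun a b z => G (a, b) *
    ENNReal.ofReal ((planeNorm ((a, b) - (x 0, x 1)) ^ 2 + (z - x 2) ^ 2)⁻¹))
    (by fun_prop)]
  refine lintegral_congr_ae ?_
  filter_upwards [ae_planeNorm_sub_pos (x 0, x 1)] with p hp
  rw [lintegral_const_mul _ (by fun_prop), lintegral_inv_sq_add_sq hp]

lemma rad_eq_planeNorm (x : E3) : rad x = planeNorm (x 0, x 1) := rfl

lemma measurable_rad : Measurable rad := by
  unfold rad; fun_prop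

/-- The axis is a null set, so pointwise bounds known only off the axis suffice under the integral.
-/
lemma ae_rad_pos : ∀ᵐ y : E3, 0 < rad y := by
  have hm := measurable_planeNorm
  have h := lintegral_euclideanSpace_three
    (f := fun a b _ => if planeNorm (a, b) ≤ 0 then 1 else 0)
    (Measurable.ite (measurableSet_le (by fun_prop) measurable_const)
      measurable_const measurable_const)
  have h0 : ∫⁻ p : ℝ × ℝ, ∫⁻ _z : ℝ, (if planeNorm (p.1, p.2) ≤ 0 then 1 else 0 : ℝ≥0∞) = 0 := by
    rw [lintegral_congr_ae (g := fun _ => 0), lintegral_zero]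
    filter_upwards [ae_planeNorm_pos] with p hp
    simp [not_le.mpr hp]
  rw [h0, lintegral_eq_zero_iff (Measurable.ite (measurableSet_le
    (by fun_prop) measurable_const) measurable_const measurable_const)] at h
  filter_upwards [h] with y hy
  by_contra hc
  rw [rad_eq_planeNorm, not_lt] at hc
  simp [hc] at hy

lemma lintegral_Ioc_ofReal {f : ℝ → ℝ} {a b : ℝ} (hab : a ≤ b)
    (hf : IntervalIntegrable f volume a b) (h0 : ∀ s ∈ Set.Ioc a b, 0 ≤ f s) :
    ∫⁻ s in Set.Ioc a b, ENNReal.ofReal (f s) = ENNReal.ofReal (∫ s in a..b, f s) := by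
  rw [intervalIntegral.integral_of_le hab, ofReal_integral_eq_lintegral_ofReal
    ((intervalIntegrable_iff_integrableOn_Ioc_of_le hab).mp hf)]
  exact (ae_restrict_iff' measurableSet_Ioc).mpr (Eventually.of_forall h0)

lemma lintegral_Ioi_rpow {a c : ℝ} (ha : a < -1) (hc : 0 < c) :
    ∫⁻ s in Set.Ioi c, ENNReal.ofReal (s ^ a) = ENNReal.ofReal (c ^ (a + 1) / (-(a + 1))) := by
  rw [← ofReal_integral_eq_lintegral_ofReal (integrableOn_Ioi_rpow_of_lt ha hc),
    integral_Ioi_rpow_of_lt ha hc]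
  · congr 1; rw [neg_div, div_neg]
  · exact (ae_restrict_iff' measurableSet_Ioi).mpr (Eventually.of_forall fun s hs =>
      Real.rpow_nonneg (hc.le.trans (le_of_lt hs)) _)

lemma lintegral_planeNorm_ball {ρ : ℝ} (hρ : 0 < ρ) :
    ∫⁻ p, (Set.Iic ρ).indicator (fun _ => (1 : ℝ≥0∞)) (planeNorm p)
      ≤ ENNReal.ofReal (2 * Real.pi * ρ ^ 2) := by
  rw [lintegral_planeNorm (measurable_const.indicator measurableSet_Iic)]
  have : ∀ s : ℝ, ENNReal.ofReal s * (Set.Iic ρ).indicator (fun _ => (1 : ℝ≥0∞)) s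
      ≤ (Set.Iic ρ).indicator (fun _ => ENNReal.ofReal ρ) s := fun s => by
    by_cases h : s ≤ ρ
    · simpa [h] using ENNReal.ofReal_le_ofReal h
    · simp [h]
  calc _ ≤ ENNReal.ofReal (2 * Real.pi) *
        ∫⁻ s in Set.Ioi 0, (Set.Iic ρ).indicator (fun _ => ENNReal.ofReal ρ) s := by
        gcongr with s; exact this s
    _ = ENNReal.ofReal (2 * Real.pi * ρ ^ 2) := by
        rw [lintegral_indicator_const measurableSet_Iic,
          Measure.restrict_apply measurableSet_Iic, Set.inter_comm, Set.Ioi_inter_Iic,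
          Real.volume_Ioc, sub_zero, ← ENNReal.ofReal_mul hρ.le,
          ← ENNReal.ofReal_mul (by positivity), sq]

/-- The polar Jacobian s turns the exponent -β into 1 - β. -/
lemma lintegral_planeNorm_indicator_rpow (β : ℝ) {t : Set ℝ} (ht : MeasurableSet t)
    (h0 : t ⊆ Set.Ioi 0) :
    ∫⁻ p, t.indicator (fun s => ENNReal.ofReal (s ^ (-β))) (planeNorm p)
      = ENNReal.ofReal (2 * Real.pi) * ∫⁻ s in t, ENNReal.ofReal (s ^ (1 - β)) := by
  rw [lintegral_planeNorm (Measurable.indicator (by fun_prop) ht)]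
  congr 1
  have : ∀ s : ℝ, ENNReal.ofReal s * t.indicator (fun s => ENNReal.ofReal (s ^ (-β))) s
      = t.indicator (fun s => ENNReal.ofReal (s ^ (1 - β))) s := fun s => by
    by_cases h : s ∈ t
    · have hs : 0 < s := h0 h
      rw [Set.indicator_of_mem h, Set.indicator_of_mem h, ← ENNReal.ofReal_mul hs.le,
        sub_eq_add_neg, Real.rpow_add hs, Real.rpow_one]
    · simp [h]
  simp only [this]
  rw [setLIntegral_indicator ht, Set.inter_eq_left.mpr h0]

/-! ### The potential in the inner, middle and outer regions. -/

lemma planeNorm_sub_ge {p q : ℝ × ℝ} {r : ℝ} (hr : planeNorm q = r) (hp : planeNorm p ≤ r / 2) :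
    r / 2 ≤ planeNorm (p - q) := by
  have := planeNorm_le_add p q
  linarith

/-- Sources at distance at most `r / 2` from the axis see the kernel at distance at least
`r / 2`. -/
lemma lintegral_near_kernel_le {F : ℝ → ℝ≥0∞} (hF : Measurable F) {x : E3} (hr : 0 < rad x)
    (h0 : ∀ s, rad x / 2 < s → F s = 0) :
    ∫⁻ y : E3, F (rad y) * ENNReal.ofReal ((‖y - x‖ ^ 2)⁻¹)
      ≤ ENNReal.ofReal (2 * Real.pi / rad x) * ∫⁻ p, F (planeNorm p) := by
  have h := lintegral_mul_kernel (hF.comp measurable_planeNorm) x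
  simp only [Function.comp_apply, ← rad_eq_planeNorm] at h
  have hFm : Measurable fun p => F (planeNorm p) := hF.comp measurable_planeNorm
  rw [h, ← lintegral_const_mul _ hFm]
  refine lintegral_mono fun p => ?_
  dsimp only
  rw [mul_comm]
  by_cases hp : planeNorm p ≤ rad x / 2
  · gcongr ?_ * _
    apply ENNReal.ofReal_le_ofReal
    have := planeNorm_sub_ge (rad_eq_planeNorm x).symm hp
    rw [div_le_div_iff₀ (by linarith) hr]
    nlinarith [Real.pi_pos]
  · simp [h0 _ (not_le.mp hp)]

lemma lintegral_inner_kernel_le {ρ : ℝ} {x : E3} (hr : 0 < rad x) (hρ : 0 < ρ)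
    (hρr : ρ ≤ rad x / 2) :
    ∫⁻ y : E3, (Set.Iic ρ).indicator (fun _ => (1 : ℝ≥0∞)) (rad y) *
        ENNReal.ofReal ((‖y - x‖ ^ 2)⁻¹)
      ≤ ENNReal.ofReal (4 * Real.pi ^ 2 * ρ ^ 2 / rad x) := by
  refine (lintegral_near_kernel_le (measurable_const.indicator measurableSet_Iic) hr
    fun s hs => by simp [hρr.trans_lt hs]).trans ?_
  calc _ ≤ ENNReal.ofReal (2 * Real.pi / rad x) * ENNReal.ofReal (2 * Real.pi * ρ ^ 2) := by
        gcongr; exact lintegral_planeNorm_ball hρ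
    _ = _ := by rw [← ENNReal.ofReal_mul (by positivity)]; congr 1; ring

lemma lintegral_middle_kernel_le {ρ β S : ℝ} {x : E3} (hr : 0 < rad x) (hρ : 0 < ρ)
    (hS : ∫⁻ s in Set.Ioc ρ (rad x / 2), ENNReal.ofReal (s ^ (1 - β)) ≤ ENNReal.ofReal S) :
    ∫⁻ y : E3, (Set.Ioc ρ (rad x / 2)).indicator (fun s => ENNReal.ofReal (s ^ (-β))) (rad y) *
        ENNReal.ofReal ((‖y - x‖ ^ 2)⁻¹)
      ≤ ENNReal.ofReal (4 * Real.pi ^ 2 * (S / rad x)) := by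
  refine (lintegral_near_kernel_le (Measurable.indicator (by fun_prop) measurableSet_Ioc) hr
    fun s hs => by simp [hs]).trans ?_
  rw [lintegral_planeNorm_indicator_rpow β measurableSet_Ioc
    fun s hs => hρ.trans hs.1]
  calc _ ≤ ENNReal.ofReal (2 * Real.pi / rad x) * (ENNReal.ofReal (2 * Real.pi) *
          ENNReal.ofReal S) := by gcongr
    _ = _ := by
        rw [← ENNReal.ofReal_mul (by positivity), ← ENNReal.ofReal_mul (by positivity)]
        congr 1; ring

lemma lintegral_planeNorm_outer {β c : ℝ} (hβ : 1 < β) (hc : 0 < c) :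
    ∫⁻ p, (Set.Ioi c).indicator (fun s => ENNReal.ofReal (s ^ (-(β + 1)))) (planeNorm p)
      = ENNReal.ofReal (2 * Real.pi * (c ^ (1 - β) / (β - 1))) := by
  rw [lintegral_planeNorm_indicator_rpow _ measurableSet_Ioi fun s hs => hc.trans hs,
    lintegral_Ioi_rpow (by linarith) hc, ← ENNReal.ofReal_mul (by positivity)]
  congr 3 <;> ring_nf

lemma lintegral_outer_kernel_le {β : ℝ} (hβ : 1 < β) {x : E3} (hr : 0 < rad x) :
    ∫⁻ y : E3, (Set.Ioi (rad x / 2)).indicator (fun s => ENNReal.ofReal (s ^ (-β))) (rad y) *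
        ENNReal.ofReal ((‖y - x‖ ^ 2)⁻¹)
      ≤ ENNReal.ofReal (2 * Real.pi ^ 2 * (1 + 2 / (β - 1)) * (rad x / 2) ^ (1 - β)) := by
  have hβ1 : 0 < β - 1 := by linarith
  have hm := measurable_planeNorm
  set c := rad x / 2 with hc
  have hc0 : 0 < c := by positivity
  set q := (x 0, x 1)
  have hF : Measurable ((Set.Ioi c).indicator (fun s : ℝ => ENNReal.ofReal (s ^ (-β)))) :=
    Measurable.indicator (by fun_prop) measurableSet_Ioi
  have hF1 : Measurable ((Set.Ioc 0 c).indicator (fun s : ℝ => ENNReal.ofReal (s ^ (-1 : ℝ)))) :=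
    Measurable.indicator (by fun_prop) measurableSet_Ioc
  have hF2 : Measurable ((Set.Ioi c).indicator
      (fun s : ℝ => ENNReal.ofReal (s ^ (-(β + 1))))) :=
    Measurable.indicator (by fun_prop) measurableSet_Ioi
  have h := lintegral_mul_kernel (hF.comp hm) x
  simp only [Function.comp_apply, ← rad_eq_planeNorm] at h
  rw [h]
  -- Write a and d for the planar distances from the source to the axis and to x, with a > c. If d ≤
  -- c, then a^(-β) ≤ c^(-β) and d⁻¹ is integrable on the disc. If d > c, then a^(-β) d⁻¹ is at most
  -- the power -(β + 1) of the smaller of a and d; both such powers are integrable beyond c because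
  -- β > 1.
  have hpt : ∀ᵐ p : ℝ × ℝ, (Set.Ioi c).indicator (fun s => ENNReal.ofReal (s ^ (-β)))
        (planeNorm p) * ENNReal.ofReal (Real.pi / planeNorm (p - q))
      ≤ ENNReal.ofReal Real.pi * (ENNReal.ofReal (c ^ (-β)) *
          (Set.Ioc 0 c).indicator (fun s => ENNReal.ofReal (s ^ (-1 : ℝ))) (planeNorm (p - q))
        + ((Set.Ioi c).indicator (fun s => ENNReal.ofReal (s ^ (-(β + 1)))) (planeNorm p)
        + (Set.Ioi c).indicator (fun s => ENNReal.ofReal (s ^ (-(β + 1))))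
          (planeNorm (p - q)))) := by
    filter_upwards [ae_planeNorm_sub_pos q] with p hd
    generalize planeNorm (p - q) = d at hd ⊢
    generalize planeNorm p = a
    by_cases ha : c < a
    swap
    · simp [ha]
    have ha0 : 0 < a := hc0.trans ha
    rw [Set.indicator_of_mem (Set.mem_Ioi.mpr ha), div_eq_mul_inv, mul_comm,
      ENNReal.ofReal_mul Real.pi_pos.le, mul_assoc, ← ENNReal.ofReal_mul (by positivity),
      ← Real.rpow_neg_one]
    gcongr ENNReal.ofReal Real.pi * ?_
    by_cases hdc : d ≤ c
    · refine le_trans ?_ le_self_add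
      rw [Set.indicator_of_mem (Set.mem_Ioc.mpr ⟨hd, hdc⟩), ← ENNReal.ofReal_mul (by positivity),
        mul_comm]
      apply ENNReal.ofReal_le_ofReal
      gcongr ?_ * _
      exact Real.rpow_le_rpow_of_nonpos hc0 ha.le (by linarith)
    · push Not at hdc
      refine le_trans ?_ le_add_self
      rw [Set.indicator_of_mem (Set.mem_Ioi.mpr ha), Set.indicator_of_mem (Set.mem_Ioi.mpr hdc)]
      have hsplit : ∀ s : ℝ, 0 < s → s ^ (-(β + 1)) = s ^ (-1 : ℝ) * s ^ (-β) := fun s hs => by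
        rw [← Real.rpow_add hs]; congr 1; ring
      rcases le_total d a with hda | hda
      · refine le_trans (ENNReal.ofReal_le_ofReal ?_) le_add_self
        rw [hsplit d hd]
        gcongr _ * ?_
        exact Real.rpow_le_rpow_of_nonpos hd hda (by linarith)
      · refine le_trans (ENNReal.ofReal_le_ofReal ?_) le_self_add
        rw [hsplit a ha0]
        gcongr ?_ * _
        exact Real.rpow_le_rpow_of_nonpos ha0 hda (by norm_num)
  refine (lintegral_mono_ae hpt).trans_eq ?_
  rw [lintegral_const_mul _ (by fun_prop), lintegral_add_left (by fun_prop),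
    lintegral_add_left (by fun_prop), lintegral_const_mul _ (by fun_prop),
    lintegral_planeNorm_sub, lintegral_planeNorm_sub, lintegral_planeNorm_outer hβ hc0,
    lintegral_planeNorm_indicator_rpow 1 measurableSet_Ioc fun s hs => hs.1]
  have h1 : ∫⁻ s in Set.Ioc 0 c, ENNReal.ofReal (s ^ (1 - 1 : ℝ)) = ENNReal.ofReal c := by simp
  have h2 : c ^ (1 - β) = c * c ^ (-β) := by
    rw [sub_eq_add_neg, Real.rpow_add hc0, Real.rpow_one]
  rw [h1, ← ENNReal.ofReal_mul (by positivity), ← ENNReal.ofReal_mul (by positivity),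
    ← ENNReal.ofReal_add (by positivity) (by positivity),
    ← ENNReal.ofReal_add (by positivity) (by positivity), ← ENNReal.ofReal_mul (by positivity), h2]
  congr 1; ring

/-- The Biot-Savart potential of a density bounded by `C₀ r^(-β)` and square integrable,
split at the distance `ρ` from the axis. -/
lemma lintegral_potential_le {β C₀ D ρ S : ℝ} (hβ : 1 < β) (hC₀ : 0 ≤ C₀) (hD : 0 ≤ D)
    {g : E3 → ℝ} (hgm : Measurable g)
    (hg : ∀ y, 0 < rad y → g y ≤ C₀ * rad y ^ (-β))
    (hgD : ∫⁻ y, ENNReal.ofReal (g y ^ 2) ≤ ENNReal.ofReal D) {x : E3} (hr : 0 < rad x)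
    (hρ : 0 < ρ) (hρr : ρ ≤ rad x / 2) (hS0 : 0 ≤ S)
    (hS : ∫⁻ s in Set.Ioc ρ (rad x / 2), ENNReal.ofReal (s ^ (1 - β)) ≤ ENNReal.ofReal S) :
    ∫⁻ y, ENNReal.ofReal ((‖y - x‖ ^ 2)⁻¹ * g y) ≤ ENNReal.ofReal
      ((D + 16 * Real.pi ^ 2) * (ρ * rad x ^ (-(3 / 2) : ℝ)) + C₀ * (4 * Real.pi ^ 2) * (S / rad x)
        + C₀ * (2 * Real.pi ^ 2 * (1 + 2 / (β - 1))) * (rad x / 2) ^ (1 - β)) := by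
  have hβ1 : 0 < β - 1 := by linarith
  have hm := measurable_rad
  set r := rad x with hrdef
  -- This weight balances Young's inequality: the squared kernel integrated over s ≤ ρ is of order
  -- ρ²/r³ = l², so both l ∫ g² and l⁻¹ ∫ k² are of order l.
  set l := ρ * r ^ (-(3 / 2) : ℝ) with hl
  have hl0 : 0 < l := by positivity
  let k : E3 → ℝ := fun y => (‖y - x‖ ^ 2)⁻¹
  have hk0 : ∀ y, 0 ≤ k y := fun y => by positivity
  have hkm : Measurable k := by fun_prop
  let T₂ : E3 → ℝ≥0∞ := fun y => (Set.Iic ρ).indicator (fun _ => (1 : ℝ≥0∞)) (rad y) *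
    ENNReal.ofReal (k y)
  let T₃ : E3 → ℝ≥0∞ := fun y => (Set.Ioc ρ (r / 2)).indicator
    (fun s => ENNReal.ofReal (s ^ (-β))) (rad y) * ENNReal.ofReal (k y)
  let T₄ : E3 → ℝ≥0∞ := fun y => (Set.Ioi (r / 2)).indicator
    (fun s => ENNReal.ofReal (s ^ (-β))) (rad y) * ENNReal.ofReal (k y)
  have hT₂ : Measurable T₂ :=
    ((measurable_const.indicator measurableSet_Iic).comp hm).mul hkm.ennreal_ofReal
  have hT₃ : Measurable T₃ := Measurable.mul (Measurable.comp (Measurable.indicator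
    (by fun_prop) measurableSet_Ioc) hm) hkm.ennreal_ofReal
  have hpt : ∀ᵐ y : E3, ENNReal.ofReal (k y * g y) ≤ ENNReal.ofReal l * ENNReal.ofReal (g y ^ 2)
      + (ENNReal.ofReal (l⁻¹ * (4 / r ^ 2)) * T₂ y + (ENNReal.ofReal C₀ * T₃ y
        + ENNReal.ofReal C₀ * T₄ y)) := by
    filter_upwards [ae_rad_pos] with y hy
    have hfar : ∀ t : Set ℝ, rad y ∈ t → ENNReal.ofReal (k y * g y) ≤ ENNReal.ofReal C₀ *
        (t.indicator (fun s => ENNReal.ofReal (s ^ (-β))) (rad y) * ENNReal.ofReal (k y)) := by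
      intro t ht
      rw [Set.indicator_of_mem ht, ← mul_assoc, ← ENNReal.ofReal_mul hC₀,
        ← ENNReal.ofReal_mul (by positivity), mul_comm]
      exact ENNReal.ofReal_le_ofReal (mul_le_mul_of_nonneg_right (hg y hy) (hk0 y))
    by_cases h1 : rad y ≤ ρ
    · rw [← add_assoc]
      refine le_trans ?_ le_self_add
      have hT : T₂ y = ENNReal.ofReal (k y) := by simp [T₂, h1]
      rw [hT, ← ENNReal.ofReal_mul hl0.le, ← ENNReal.ofReal_mul (by positivity),
        ← ENNReal.ofReal_add (by positivity) (mul_nonneg (by positivity) (hk0 y))]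
      apply ENNReal.ofReal_le_ofReal
      have hk : k y ≤ 4 / r ^ 2 := by
        have hd := planeNorm_sub_ge (p := (y 0, y 1)) (rad_eq_planeNorm x).symm (h1.trans hρr)
        have hn : (r / 2) ^ 2 ≤ ‖y - x‖ ^ 2 := by
          rw [EuclideanSpace.norm_sq_eq, Fin.sum_univ_three]
          calc (r / 2) ^ 2 ≤ planeNorm ((y 0, y 1) - (x 0, x 1)) ^ 2 := by gcongr
            _ = (y 0 - x 0) ^ 2 + (y 1 - x 1) ^ 2 := by rw [planeNorm_sq]; rfl
            _ ≤ _ := by simp [sq_nonneg]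
        calc k y ≤ ((r / 2) ^ 2)⁻¹ := inv_anti₀ (by positivity) hn
          _ = 4 / r ^ 2 := by field_simp; norm_num
      have hsq : k y * k y ≤ 4 / r ^ 2 * k y := mul_le_mul_of_nonneg_right hk (hk0 y)
      -- Young's inequality by completing the square; no sign of g is needed.
      have ham : k y * g y ≤ l * g y ^ 2 + l⁻¹ * (k y * k y) := by
        have h2 : 0 ≤ l⁻¹ * ((l * g y - k y / 2) ^ 2 + 3 / 4 * k y ^ 2) := by positivity
        have h3 : l⁻¹ * ((l * g y - k y / 2) ^ 2 + 3 / 4 * k y ^ 2)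
            = l * g y ^ 2 + l⁻¹ * (k y * k y) - k y * g y := by field_simp; ring
        linarith
      have := mul_le_mul_of_nonneg_left hsq (inv_pos.mpr hl0).le
      linarith
    · push Not at h1
      rw [← add_assoc]
      refine le_trans ?_ le_add_self
      by_cases h2 : rad y ≤ r / 2
      · exact (hfar _ (Set.mem_Ioc.mpr ⟨h1, h2⟩)).trans le_self_add
      · exact (hfar _ (Set.mem_Ioi.mpr (not_le.mp h2))).trans le_add_self
  refine (lintegral_mono_ae hpt).trans ?_
  rw [lintegral_add_left (by fun_prop), lintegral_add_left (by fun_prop),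
    lintegral_add_left (by fun_prop), lintegral_const_mul _ (by fun_prop),
    lintegral_const_mul _ hT₂, lintegral_const_mul _ hT₃,
    lintegral_const_mul' _ _ ENNReal.ofReal_ne_top]
  calc _ ≤ ENNReal.ofReal l * ENNReal.ofReal D + (ENNReal.ofReal (l⁻¹ * (4 / r ^ 2)) *
        ENNReal.ofReal (4 * Real.pi ^ 2 * ρ ^ 2 / r) + (ENNReal.ofReal C₀ *
        ENNReal.ofReal (4 * Real.pi ^ 2 * (S / r)) + ENNReal.ofReal C₀ *
        ENNReal.ofReal (2 * Real.pi ^ 2 * (1 + 2 / (β - 1)) * (r / 2) ^ (1 - β)))) := by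
        gcongr
        · exact lintegral_inner_kernel_le hr hρ hρr
        · exact lintegral_middle_kernel_le hr hρ hS
        · exact lintegral_outer_kernel_le hβ hr
    _ = _ := by
        rw [← ENNReal.ofReal_mul (by positivity), ← ENNReal.ofReal_mul (by positivity),
          ← ENNReal.ofReal_mul (by positivity), ← ENNReal.ofReal_mul (by positivity),
          ← ENNReal.ofReal_add (by positivity) (by positivity),
          ← ENNReal.ofReal_add (by positivity) (by positivity),
          ← ENNReal.ofReal_add (by positivity) (by positivity)]
        congr 1
        have h3 : l⁻¹ * (4 / r ^ 2) * (4 * Real.pi ^ 2 * ρ ^ 2 / r) = 16 * Real.pi ^ 2 * l := by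
          have hrr : r ^ (-(3 / 2) : ℝ) * r ^ (-(3 / 2) : ℝ) * r ^ 3 = 1 := by
            rw [← Real.rpow_add hr, ← Real.rpow_natCast, ← Real.rpow_add hr]; norm_num
          have hll : l * l * r ^ 3 = ρ ^ 2 := by
            rw [hl]; linear_combination ρ ^ 2 * hrr
          rw [← hll]; field_simp; ring
        rw [h3]; ring

/-! ### Choice of the splitting radius. -/

lemma rpow_le_rpow_one_add {a r : ℝ} (ha : a ≤ 0) (hr : 1 < r) :
    r ^ a ≤ 2 ^ (-a) * (1 + r) ^ a := by
  have h : ((1 + r) / 2) ^ a = 2 ^ (-a) * (1 + r) ^ a := by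
    rw [Real.div_rpow (by linarith) (by norm_num), Real.rpow_neg (by norm_num)]
    field_simp
  rw [← h]
  exact Real.rpow_le_rpow_of_nonpos (by linarith) (by linarith) ha

lemma half_rpow {a r : ℝ} (hr : 0 < r) : (r / 2) ^ a = 2 ^ (-a) * r ^ a := by
  rw [Real.div_rpow hr.le (by norm_num), Real.rpow_neg (by norm_num)]
  field_simp

/-- The splitting radius for the exponent `β`: each of the three contributions to the potential
is controlled by `decayRate β r`. -/
lemma exists_splitting_radius {β : ℝ} (hβ : 1 < β) : ∃ K : ℝ, 0 ≤ K ∧ ∀ r : ℝ, 1 < r →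
    ∃ ρ S : ℝ, 0 < ρ ∧ ρ ≤ r / 2 ∧ 0 ≤ S ∧
      ∫⁻ s in Set.Ioc ρ (r / 2), ENNReal.ofReal (s ^ (1 - β)) ≤ ENNReal.ofReal S ∧
      ρ * r ^ (-(3 / 2) : ℝ) ≤ K * decayRate β r ∧ S / r ≤ K * decayRate β r ∧
      (r / 2) ^ (1 - β) ≤ K * decayRate β r := by
  suffices H : ∃ K₁ K₂ K₃ : ℝ, ∀ r : ℝ, 1 < r → 0 ≤ decayRate β r ∧
      ∃ ρ S : ℝ, 0 < ρ ∧ ρ ≤ r / 2 ∧ 0 ≤ S ∧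
      ∫⁻ s in Set.Ioc ρ (r / 2), ENNReal.ofReal (s ^ (1 - β)) ≤ ENNReal.ofReal S ∧
      ρ * r ^ (-(3 / 2) : ℝ) ≤ K₁ * decayRate β r ∧ S / r ≤ K₂ * decayRate β r ∧
      (r / 2) ^ (1 - β) ≤ K₃ * decayRate β r by
    obtain ⟨K₁, K₂, K₃, H⟩ := H
    refine ⟨|K₁| + |K₂| + |K₃|, by positivity, fun r hr => ?_⟩
    obtain ⟨h0, ρ, S, h1, h2, h3, h4, h5, h6, h7⟩ := H r hr
    have hK₁ := le_abs_self K₁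
    have hK₂ := le_abs_self K₂
    have hK₃ := le_abs_self K₃
    have := abs_nonneg K₁
    have := abs_nonneg K₂
    have := abs_nonneg K₃
    exact ⟨ρ, S, h1, h2, h3, h4, h5.trans (mul_le_mul_of_nonneg_right (by linarith) h0),
      h6.trans (mul_le_mul_of_nonneg_right (by linarith) h0),
      h7.trans (mul_le_mul_of_nonneg_right (by linarith) h0)⟩
  rcases lt_trichotomy β 2 with hlt | rfl | hgt
  · have hΦ : ∀ r, decayRate β r = (1 + r) ^ (1 - β) := fun r => by
      rw [decayRate, if_neg hlt.not_gt, if_neg hlt.ne]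
    refine ⟨2 ^ (-(1 - β)), 2 ^ (-(1 - β)) * 2 ^ (-(1 - β)) / (2 * (2 - β)),
      2 ^ (-(1 - β)) * 2 ^ (-(1 - β)), fun r hr => ?_⟩
    have hr0 : 0 < r := by linarith
    have h2β : 0 < 2 - β := by linarith
    rw [hΦ]
    have hone := rpow_le_rpow_one_add (a := 1 - β) (by linarith) hr
    have hhalf : (r / 2) ^ (1 - β) ≤ 2 ^ (-(1 - β)) * 2 ^ (-(1 - β)) * (1 + r) ^ (1 - β) := by
      rw [half_rpow hr0, mul_assoc]; gcongr
    refine ⟨by positivity, 1 / 2, (r / 2) ^ (2 - β) / (2 - β), by norm_num, by linarith,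
      by positivity, ?_, ?_, ?_, hhalf⟩
    · calc _ ≤ ∫⁻ s in Set.Ioc 0 (r / 2), ENNReal.ofReal (s ^ (1 - β)) :=
            lintegral_mono_set (Set.Ioc_subset_Ioc_left (by norm_num))
        _ = _ := by
            rw [lintegral_Ioc_ofReal (by positivity)
              (intervalIntegral.intervalIntegrable_rpow' (by linarith))
              fun s hs => Real.rpow_nonneg hs.1.le _, integral_rpow (Or.inl (by linarith)),
              Real.zero_rpow (by linarith), sub_zero]
            congr 2 <;> ring_nf
    · calc 1 / 2 * r ^ (-(3 / 2) : ℝ) ≤ 1 * r ^ (1 - β) := by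
            gcongr
            · norm_num
            · exact hr.le
            · linarith
        _ ≤ _ := by rw [one_mul]; exact hone
    · have : (r / 2) ^ (2 - β) = r / 2 * (r / 2) ^ (1 - β) := by
        rw [← Real.rpow_one_add' (by positivity) (by linarith)]; ring_nf
      rw [this]
      calc _ = (r / 2) ^ (1 - β) / (2 * (2 - β)) := by field_simp
        _ ≤ 2 ^ (-(1 - β)) * 2 ^ (-(1 - β)) * (1 + r) ^ (1 - β) / (2 * (2 - β)) := by gcongr
        _ = _ := by ring
  -- For β = 2 the middle integral from 1/2 to r/2 is exactly log r. The other two terms are O(r⁻¹)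
  -- and are absorbed through log(1 + r) ≥ log 2.
  · have hΦ : ∀ r, decayRate 2 r = (1 + r)⁻¹ * Real.log (1 + r) := fun r => by simp [decayRate]
    have hlog2 : 0 < Real.log 2 := Real.log_pos (by norm_num)
    refine ⟨2 / Real.log 2, 2, 2 * (2 / Real.log 2), fun r hr => ?_⟩
    have hr0 : 0 < r := by linarith
    have hlog : Real.log 2 ≤ Real.log (1 + r) := Real.log_le_log (by norm_num) (by linarith)
    have hlogr : Real.log r ≤ Real.log (1 + r) := Real.log_le_log hr0 (by linarith)
    have hinv : r⁻¹ ≤ 2 * (1 + r)⁻¹ := by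
      rw [inv_eq_one_div, ← div_eq_mul_inv, div_le_div_iff₀ hr0 (by linarith)]; linarith
    have hpos : 0 < (1 + r)⁻¹ := by positivity
    have hmain : r⁻¹ ≤ 2 / Real.log 2 * ((1 + r)⁻¹ * Real.log (1 + r)) :=
      calc r⁻¹ ≤ 2 * (1 + r)⁻¹ := hinv
        _ = 2 / Real.log 2 * ((1 + r)⁻¹ * Real.log 2) := by field_simp
        _ ≤ _ := by gcongr
    rw [hΦ]
    refine ⟨mul_nonneg hpos.le (hlog2.le.trans hlog), 1 / 2, Real.log r, by norm_num, by linarith,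
      Real.log_nonneg hr.le, ?_, ?_, ?_, ?_⟩
    · have : ∀ s : ℝ, s ^ (1 - 2 : ℝ) = s⁻¹ := fun s => by
        rw [← Real.rpow_neg_one]; norm_num
      simp only [this]
      have h0 : (0 : ℝ) ∉ Set.uIcc (1 / 2) (r / 2) := by
        rw [Set.uIcc_of_le (by linarith)]; intro h; linarith [h.1]
      rw [lintegral_Ioc_ofReal (by linarith) (intervalIntegral.intervalIntegrable_inv
        (fun s hs hs0 => h0 (hs0 ▸ hs)) continuousOn_id)
        fun s hs => inv_nonneg.mpr (by linarith [hs.1]),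
        integral_inv_of_pos (by norm_num) (by linarith)]
      apply le_of_eq; congr 2; ring
    · calc 1 / 2 * r ^ (-(3 / 2) : ℝ) ≤ 1 * r ^ (-1 : ℝ) := by
            gcongr
            · norm_num
            · exact hr.le
            · norm_num
        _ = r⁻¹ := by rw [one_mul, Real.rpow_neg_one]
        _ ≤ _ := hmain
    · calc Real.log r / r = Real.log r * r⁻¹ := rfl
        _ ≤ Real.log (1 + r) * (2 * (1 + r)⁻¹) :=
            mul_le_mul hlogr hinv (by positivity) (hlog2.le.trans hlog)
        _ = _ := by ring
    · have : (r / 2) ^ (1 - 2 : ℝ) = 2 * r⁻¹ := by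
        rw [show (1 - 2 : ℝ) = -1 by norm_num, Real.rpow_neg_one]; field_simp
      rw [this, mul_assoc]; gcongr
  -- For β > 2 the middle integral is dominated by its lower end and gives ρ^(2-β)/r. Equating this
  -- with ρ r^(-3/2) gives ρ^(β-1) = r^(1/2), that is ρ = r^γ; the factor 1/2 used below ensures ρ ≤
  -- r/2.
  · obtain ⟨γ, hγ⟩ : ∃ γ, γ = 1 / (2 * (β - 1)) := ⟨_, rfl⟩
    have hβ1 : 0 < β - 1 := by linarith
    have hγβ : γ * (β - 1) = 1 / 2 := by rw [hγ]; field_simp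
    have hγ0 : 0 < γ := by rw [hγ]; positivity
    have hγ1 : γ < 1 / 2 := by nlinarith
    have hΦ : ∀ r, decayRate β r = (1 + r) ^ (-(3 / 2) + γ) := fun r => by
      rw [decayRate, if_pos hgt, hγ]
    set a := -(3 / 2) + γ with ha
    refine ⟨2⁻¹ * 2 ^ (-a), 2 ^ (-(2 - β)) / (β - 2) * 2 ^ (-a), 2 ^ (-(1 - β)) * 2 ^ (-a),
      fun r hr => ?_⟩
    have hr0 : 0 < r := by linarith
    have hβ2 : 0 < β - 2 := by linarith
    rw [hΦ]
    have hone := rpow_le_rpow_one_add (a := a) (by linarith) hr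
    refine ⟨by positivity, r ^ γ / 2, (r ^ γ / 2) ^ (2 - β) / (β - 2), by positivity, ?_,
      by positivity, ?_, ?_, ?_, ?_⟩
    · have : r ^ γ ≤ r ^ (1 : ℝ) := Real.rpow_le_rpow_of_exponent_le hr.le (by linarith)
      rw [Real.rpow_one] at this; linarith
    · calc _ ≤ ∫⁻ s in Set.Ioi (r ^ γ / 2), ENNReal.ofReal (s ^ (1 - β)) :=
            lintegral_mono_set Set.Ioc_subset_Ioi_self
        _ = _ := by
            rw [lintegral_Ioi_rpow (by linarith) (by positivity)]
            congr 2 <;> ring_nf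
    · calc r ^ γ / 2 * r ^ (-(3 / 2) : ℝ) = 2⁻¹ * r ^ a := by
            rw [ha, add_comm, Real.rpow_add hr0]; ring
        _ ≤ 2⁻¹ * (2 ^ (-a) * (1 + r) ^ a) := by gcongr
        _ = _ := by ring
    · have h1 : r ^ (γ * (2 - β)) = r * r ^ a := by
        rw [← Real.rpow_one_add' hr0.le (by linarith)]
        congr 1; rw [ha]; linear_combination -hγβ
      rw [half_rpow (by positivity), ← Real.rpow_mul hr0.le, h1]
      calc _ = 2 ^ (-(2 - β)) / (β - 2) * r ^ a := by field_simp
        _ ≤ 2 ^ (-(2 - β)) / (β - 2) * (2 ^ (-a) * (1 + r) ^ a) := by gcongr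
        _ = _ := by ring
    · rw [half_rpow hr0, mul_assoc]
      gcongr _ * ?_
      refine le_trans (Real.rpow_le_rpow_of_exponent_le hr.le ?_) hone
      -- With t = β - 1 > 1, the comparison 1 - β ≤ -3/2 + γ amounts to (2t - 1)(t - 1) ≥ 0.
      rw [ha]; nlinarith

/-! ### Decay of a field from decay of its curl. -/

/-- A divergence free field vanishing at infinity whose curl is square integrable and bounded by
`C₀ r^(-β)` decays at the rate `decayRate β r`. -/
theorem norm_le_decayRate_of_curl {β C₀ D : ℝ} (hβ : 1 < β) (hC₀ : 0 ≤ C₀) (hD : 0 ≤ D) :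
    ∃ C : ℝ, ∀ v : E3 → E3, ContDiff ℝ 1 v → (∀ y, divergence v y = 0) →
      Tendsto v (cocompact E3) (𝓝 0) →
      (∀ y, 0 < rad y → ‖curl v y‖ ≤ C₀ * rad y ^ (-β)) →
      ∫⁻ y, ENNReal.ofReal (‖curl v y‖ ^ 2) ≤ ENNReal.ofReal D →
      ∀ x, 1 < rad x → ‖v x‖ ≤ C * decayRate β (rad x) := by
  obtain ⟨A, hA⟩ := norm_le_lintegral_curl
  obtain ⟨K, hK0, hK⟩ := exists_splitting_radius hβ
  have hβ1 : 0 < β - 1 := by linarith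
  refine ⟨A * ((D + 16 * Real.pi ^ 2) * K + C₀ * (4 * Real.pi ^ 2) * K
    + C₀ * (2 * Real.pi ^ 2 * (1 + 2 / (β - 1))) * K), fun v hv hdiv hlim hcurl hint x hx => ?_⟩
  obtain ⟨ρ, S, hρ, hρr, hS0, hS, h1, h2, h3⟩ := hK (rad x) hx
  have hm : Measurable fun y => ‖curl v y‖ := by
    have hp : ∀ j, Continuous (pd j v) := continuous_pd hv
    have hc : Continuous (curl v) := by
      unfold curl
      refine (PiLp.continuous_toLp 2 _).comp (continuous_pi fun i => ?_)
      fin_cases i <;> simp <;> fun_prop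
    exact hc.norm.measurable
  have hle := lintegral_potential_le hβ hC₀ hD hm hcurl hint (by linarith) hρ hρr hS0 hS
  have hv' := (hA v hv hdiv hlim x).trans (mul_le_mul_right hle _)
  rw [← ofReal_norm, ← ENNReal.ofReal_coe_nnreal, ← ENNReal.ofReal_mul A.coe_nonneg,
    ENNReal.ofReal_le_ofReal_iff] at hv'
  · refine hv'.trans ?_
    rw [mul_assoc (A : ℝ)]
    refine mul_le_mul_of_nonneg_left ?_ A.coe_nonneg
    calc _ ≤ (D + 16 * Real.pi ^ 2) * (K * decayRate β (rad x))
          + C₀ * (4 * Real.pi ^ 2) * (K * decayRate β (rad x))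
          + C₀ * (2 * Real.pi ^ 2 * (1 + 2 / (β - 1))) * (K * decayRate β (rad x)) := by gcongr
      _ = _ := by ring
  · have : 0 < rad x := by linarith
    have := A.coe_nonneg
    positivity

/-! ### Reflections across planes containing the axis. -/

/-- The orthogonal map of `ℝ³` acting as `(c, s; s, -c)` on the first two coordinates: for
`c² + s² = 1` it is the reflection across a plane containing the axis. -/
noncomputable def axisRefl (c s : ℝ) : E3 →L[ℝ] E3 :=
  LinearMap.toContinuousLinearMap
    { toFun := fun x => !₂[c * x 0 + s * x 1, s * x 0 - c * x 1, x 2]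
      map_add' := fun x y => by ext i; fin_cases i <;> simp <;> ring
      map_smul' := fun a x => by ext i; fin_cases i <;> simp <;> ring }

@[simp] lemma axisRefl_zero (c s : ℝ) (x : E3) : axisRefl c s x 0 = c * x 0 + s * x 1 := rfl

@[simp] lemma axisRefl_one (c s : ℝ) (x : E3) : axisRefl c s x 1 = s * x 0 - c * x 1 := rfl

@[simp] lemma axisRefl_two (c s : ℝ) (x : E3) : axisRefl c s x 2 = x 2 := rfl

lemma axisRefl_axisRefl {c s : ℝ} (h : c ^ 2 + s ^ 2 = 1) (x : E3) :
    axisRefl c s (axisRefl c s x) = x := by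
  ext i
  fin_cases i <;> simp
  · linear_combination x 0 * h
  · linear_combination x 1 * h

lemma norm_axisRefl {c s : ℝ} (h : c ^ 2 + s ^ 2 = 1) (x : E3) : ‖axisRefl c s x‖ = ‖x‖ := by
  rw [EuclideanSpace.norm_eq, EuclideanSpace.norm_eq, Fin.sum_univ_three, Fin.sum_univ_three]
  simp only [Real.norm_eq_abs, sq_abs, axisRefl_zero, axisRefl_one, axisRefl_two]
  congr 1
  linear_combination (x 0 ^ 2 + x 1 ^ 2) * h

lemma rad_axisRefl {c s : ℝ} (h : c ^ 2 + s ^ 2 = 1) (x : E3) :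
    rad (axisRefl c s x) = rad x := by
  unfold rad
  simp only [axisRefl_zero, axisRefl_one]
  congr 1
  linear_combination (x 0 ^ 2 + x 1 ^ 2) * h

lemma tendsto_axisRefl_cocompact {c s : ℝ} (h : c ^ 2 + s ^ 2 = 1) :
    Tendsto (axisRefl c s) (cocompact E3) (cocompact E3) :=
  (Homeomorph.mk ⟨axisRefl c s, axisRefl c s, axisRefl_axisRefl h, axisRefl_axisRefl h⟩
    (axisRefl c s).continuous (axisRefl c s).continuous).isClosedEmbedding.tendsto_cocompact

/-- The image of a vector field under a reflection across a plane containing the axis. -/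
noncomputable def reflField (c s : ℝ) (u : E3 → E3) (y : E3) : E3 :=
  axisRefl c s (u (axisRefl c s y))

lemma fderiv_reflField {u : E3 → E3} (hu : Differentiable ℝ u) (c s : ℝ) (y h : E3) :
    fderiv ℝ (reflField c s u) y h
      = axisRefl c s (fderiv ℝ u (axisRefl c s y) (axisRefl c s h)) := by
  have h1 : HasFDerivAt (reflField c s u) _ y := (axisRefl c s).hasFDerivAt.comp y
    ((hu (axisRefl c s y)).hasFDerivAt.comp y (axisRefl c s).hasFDerivAt)
  rw [h1.fderiv]; rfl

lemma axisRefl_single_zero (c s : ℝ) : axisRefl c s (EuclideanSpace.single 0 1)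
    = c • EuclideanSpace.single 0 1 + s • EuclideanSpace.single 1 1 := by
  ext i; fin_cases i <;> simp

lemma axisRefl_single_one (c s : ℝ) : axisRefl c s (EuclideanSpace.single 1 1)
    = s • EuclideanSpace.single 0 1 - c • EuclideanSpace.single 1 1 := by
  ext i; fin_cases i <;> simp

lemma axisRefl_single_two (c s : ℝ) : axisRefl c s (EuclideanSpace.single 2 1)
    = EuclideanSpace.single 2 1 := by
  ext i; fin_cases i <;> simp

lemma pd_zero_reflField {u : E3 → E3} (hu : Differentiable ℝ u) (c s : ℝ) (y : E3) :
    pd 0 (reflField c s u) y = axisRefl c s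
      (c • pd 0 u (axisRefl c s y) + s • pd 1 u (axisRefl c s y)) := by
  unfold pd
  rw [fderiv_reflField hu, axisRefl_single_zero, map_add, map_smul, map_smul]

lemma pd_one_reflField {u : E3 → E3} (hu : Differentiable ℝ u) (c s : ℝ) (y : E3) :
    pd 1 (reflField c s u) y = axisRefl c s
      (s • pd 0 u (axisRefl c s y) - c • pd 1 u (axisRefl c s y)) := by
  unfold pd
  rw [fderiv_reflField hu, axisRefl_single_one, map_sub, map_smul, map_smul]

lemma pd_two_reflField {u : E3 → E3} (hu : Differentiable ℝ u) (c s : ℝ) (y : E3) :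
    pd 2 (reflField c s u) y = axisRefl c s (pd 2 u (axisRefl c s y)) := by
  unfold pd
  rw [fderiv_reflField hu, axisRefl_single_two]

lemma divergence_reflField {u : E3 → E3} (hu : Differentiable ℝ u) {c s : ℝ}
    (h : c ^ 2 + s ^ 2 = 1) (y : E3) :
    divergence (reflField c s u) y = divergence u (axisRefl c s y) := by
  simp only [divergence, Fin.sum_univ_three, pd_zero_reflField hu, pd_one_reflField hu,
    pd_two_reflField hu, axisRefl_zero, axisRefl_one, axisRefl_two, PiLp.add_apply,
    PiLp.sub_apply, PiLp.smul_apply, smul_eq_mul]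
  linear_combination (pd 0 u (axisRefl c s y) 0 + pd 1 u (axisRefl c s y) 1) * h

/-- Curl is a pseudovector: the reflection has determinant -1, hence the minus sign. This sign is
what exchanges meridional and azimuthal parts. -/
lemma curl_reflField {u : E3 → E3} (hu : Differentiable ℝ u) {c s : ℝ}
    (h : c ^ 2 + s ^ 2 = 1) (y : E3) :
    curl (reflField c s u) y = -axisRefl c s (curl u (axisRefl c s y)) := by
  ext i
  fin_cases i
  all_goals
    simp [curl, pd_zero_reflField hu, pd_one_reflField hu, pd_two_reflField hu]
  · ring
  · ring
  · linear_combination (pd 1 u (axisRefl c s y) 0 - pd 0 u (axisRefl c s y) 1) * h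

/-- The reflections of an axisymmetric field across planes containing the axis all coincide. -/
lemma reflField_eq {u : E3 → E3} (hu : IsAxisymmetric u) {c s c' s' : ℝ} (h : c ^ 2 + s ^ 2 = 1)
    (h' : c' ^ 2 + s' ^ 2 = 1) {y : E3} (hy : 0 < rad y) :
    reflField c s u y = reflField c' s' u y := by
  obtain ⟨ur, uθ, uz, hu⟩ := hu
  -- Whatever the plane, the reflection carries the frame at the reflected point to `er`, `-eθ`,
  -- `ez` at y, and the coefficients depend only on r and z, which it preserves.
  have key : ∀ c s : ℝ, c ^ 2 + s ^ 2 = 1 → reflField c s u y =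
      ur (rad y) (y 2) • er y - uθ (rad y) (y 2) • eθ y + uz (rad y) (y 2) • ez := by
    intro c s h
    have hr := rad_axisRefl h y
    have he : axisRefl c s (er (axisRefl c s y)) = er y := by
      ext i
      fin_cases i <;> simp [er, hr]
      · linear_combination y 0 / rad y * h
      · linear_combination y 1 / rad y * h
    have hθ : axisRefl c s (eθ (axisRefl c s y)) = -eθ y := by
      ext i
      fin_cases i <;> simp [eθ, hr]
      · linear_combination y 1 / rad y * h
      · linear_combination -y 0 / rad y * h
    have hz : axisRefl c s ez = ez := by
      ext i
      fin_cases i <;> simp [ez]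
    rw [reflField, hu _ (by rw [hr]; exact hy), map_add, map_add, map_smul, map_smul, map_smul,
      he, hθ, hz, hr, axisRefl_two]
    module
  rw [key c s h, key c' s' h']

/-! ### The reflection fixing a given point, and the cylindrical frame. -/

section Frame

variable {y : E3}

/-- The cosine of twice the polar angle. -/
noncomputable def cosTwo (y : E3) : ℝ := (y 0 / rad y) ^ 2 - (y 1 / rad y) ^ 2

/-- The sine of twice the polar angle. -/
noncomputable def sinTwo (y : E3) : ℝ := 2 * (y 0 / rad y) * (y 1 / rad y)

lemma cos_sq_add_sin_sq (hy : 0 < rad y) : (y 0 / rad y) ^ 2 + (y 1 / rad y) ^ 2 = 1 := by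
  have : rad y ^ 2 = y 0 ^ 2 + y 1 ^ 2 := Real.sq_sqrt (by positivity)
  rw [div_pow, div_pow, ← add_div, ← this, div_self (by positivity)]

lemma cosTwo_sq_add_sinTwo_sq (hy : 0 < rad y) : cosTwo y ^ 2 + sinTwo y ^ 2 = 1 := by
  have h := cos_sq_add_sin_sq hy
  unfold cosTwo sinTwo
  linear_combination ((y 0 / rad y) ^ 2 + (y 1 / rad y) ^ 2 + 1) * h

/-- The plane through the axis at polar angle φ has reflection matrix with entries cos 2φ and sin
2φ; here φ is the angle of y itself. -/
lemma axisRefl_self (hy : 0 < rad y) : axisRefl (cosTwo y) (sinTwo y) y = y := by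
  have h := cos_sq_add_sin_sq hy
  have h0 : y 0 = rad y * (y 0 / rad y) := by field_simp
  have h1 : y 1 = rad y * (y 1 / rad y) := by field_simp
  unfold cosTwo sinTwo
  generalize y 0 / rad y = C at *
  generalize y 1 / rad y = S at *
  ext i
  fin_cases i <;> simp
  · rw [h0, h1]; linear_combination rad y * C * h
  · rw [h0, h1]; linear_combination rad y * S * h

/-- The part of a vector in the meridional plane. -/
lemma half_add_axisRefl (hy : 0 < rad y) (v : E3 → E3) :
    (2⁻¹ : ℝ) • (v y + axisRefl (cosTwo y) (sinTwo y) (v y))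
      = compR v y • er y + compZ v y • ez := by
  have h := cos_sq_add_sin_sq hy
  unfold cosTwo sinTwo compR compZ er ez
  generalize y 0 / rad y = C at *
  generalize y 1 / rad y = S at *
  ext i
  fin_cases i <;> simp [PiLp.inner_apply, Fin.sum_univ_three]
  · linear_combination -(v y 0) / 2 * h
  · linear_combination -(v y 1) / 2 * h
  · ring

/-- The azimuthal part of a vector. -/
lemma half_sub_axisRefl (hy : 0 < rad y) (v : E3 → E3) :
    (2⁻¹ : ℝ) • (v y - axisRefl (cosTwo y) (sinTwo y) (v y)) = compθ v y • eθ y := by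
  have h := cos_sq_add_sin_sq hy
  unfold cosTwo sinTwo compθ eθ
  simp only [neg_div]
  generalize y 0 / rad y = C at *
  generalize y 1 / rad y = S at *
  ext i
  fin_cases i <;> simp [PiLp.inner_apply, Fin.sum_univ_three]
  · linear_combination -(v y 0) / 2 * h
  · linear_combination -(v y 1) / 2 * h

lemma norm_er (hy : 0 < rad y) : ‖er y‖ = 1 := by
  rw [EuclideanSpace.norm_eq, Real.sqrt_eq_one, Fin.sum_univ_three]
  simp only [Real.norm_eq_abs, sq_abs]
  simpa [er] using cos_sq_add_sin_sq hy

lemma norm_eθ (hy : 0 < rad y) : ‖eθ y‖ = 1 := by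
  rw [EuclideanSpace.norm_eq, Real.sqrt_eq_one, Fin.sum_univ_three]
  have := cos_sq_add_sin_sq hy
  simp only [Real.norm_eq_abs, sq_abs]
  rw [add_comm] at this
  simpa [eθ, neg_div] using this

lemma norm_ez : ‖ez‖ = 1 := by
  rw [EuclideanSpace.norm_eq, Real.sqrt_eq_one, Fin.sum_univ_three]
  simp [ez]

end Frame

/-! ### Meridional and azimuthal parts as smooth fields. -/

/-- For `ε = 1` the meridional part and for `ε = -1` the azimuthal part of an axisymmetric
field, as an everywhere smooth field. -/
noncomputable def symPart (ε : ℝ) (u : E3 → E3) (y : E3) : E3 :=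
  (2⁻¹ : ℝ) • (u y + ε • reflField 1 0 u y)

section SymPart

variable {u : E3 → E3}

lemma contDiff_reflField (hu : ContDiff ℝ 1 u) (c s : ℝ) : ContDiff ℝ 1 (reflField c s u) :=
  (axisRefl c s).contDiff.comp (hu.comp (axisRefl c s).contDiff)

lemma contDiff_symPart (hu : ContDiff ℝ 1 u) (ε : ℝ) : ContDiff ℝ 1 (symPart ε u) :=
  (hu.add ((contDiff_reflField hu 1 0).const_smul ε)).const_smul (2⁻¹ : ℝ)

lemma pd_symPart (hu : ContDiff ℝ 1 u) (ε : ℝ) (j : Fin 3) (y : E3) :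
    pd j (symPart ε u) y = (2⁻¹ : ℝ) • (pd j u y + ε • pd j (reflField 1 0 u) y) := by
  have h1 := (hu.differentiable (by norm_num) y).hasFDerivAt
  have h2 := ((contDiff_reflField hu 1 0).differentiable (by norm_num) y).hasFDerivAt
  have h : HasFDerivAt (symPart ε u) _ y := (h1.add (h2.const_smul ε)).const_smul (2⁻¹ : ℝ)
  unfold pd
  rw [h.fderiv]; rfl

lemma divergence_symPart (hu : ContDiff ℝ 1 u) (hdiv : ∀ y, divergence u y = 0) (ε : ℝ)
    (y : E3) : divergence (symPart ε u) y = 0 := by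
  have h1 := hdiv y
  have h2 : divergence (reflField 1 0 u) y = 0 := by
    rw [divergence_reflField (hu.differentiable (by norm_num)) (by norm_num), hdiv]
  simp only [divergence, Fin.sum_univ_three, pd_symPart hu, PiLp.smul_apply, PiLp.add_apply,
    smul_eq_mul] at *
  linear_combination h1 / 2 + ε / 2 * h2

lemma tendsto_symPart (hu : Tendsto u (cocompact E3) (𝓝 0)) (ε : ℝ) :
    Tendsto (symPart ε u) (cocompact E3) (𝓝 0) := by
  have h : Tendsto (reflField 1 0 u) (cocompact E3) (𝓝 0) := by
    have := ((axisRefl 1 0).continuous.tendsto 0).comp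
      (hu.comp (tendsto_axisRefl_cocompact (c := 1) (s := 0) (by norm_num)))
    rwa [map_zero] at this
  have := (hu.add (h.const_smul ε)).const_smul (2⁻¹ : ℝ)
  simp only [smul_zero, add_zero] at this
  exact this

/-- The fixed reflection in the definition, chosen for smoothness, may be replaced at each point by
the one fixing that point, which acts on the vector `u y` alone. -/
lemma symPart_eq (hu : IsAxisymmetric u) (ε : ℝ) {y : E3} (hy : 0 < rad y) :
    symPart ε u y = (2⁻¹ : ℝ) • (u y + ε • axisRefl (cosTwo y) (sinTwo y) (u y)) := by
  rw [symPart, reflField_eq hu (by norm_num) (cosTwo_sq_add_sinTwo_sq hy) hy, reflField,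
    axisRefl_self hy]

lemma curl_symPart (hu : ContDiff ℝ 1 u) (hax : IsAxisymmetric u) (ε : ℝ) {y : E3}
    (hy : 0 < rad y) : curl (symPart ε u) y
      = (2⁻¹ : ℝ) • (curl u y - ε • axisRefl (cosTwo y) (sinTwo y) (curl u y)) := by
  have hc := cosTwo_sq_add_sinTwo_sq hy
  -- The angle is frozen at y before differentiating: the two reflected fields agree on a whole
  -- neighbourhood off the axis, so their derivatives at y agree.
  have hev : reflField 1 0 u =ᶠ[𝓝 y] reflField (cosTwo y) (sinTwo y) u := by
    have hcont : Continuous rad := by unfold rad; fun_prop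
    filter_upwards [hcont.continuousAt.eventually_const_lt hy] with z hz
    exact reflField_eq hax (by norm_num) hc hz
  have hpd : ∀ j, pd j (reflField 1 0 u) y = pd j (reflField (cosTwo y) (sinTwo y) u) y :=
    fun j => by unfold pd; rw [hev.fderiv_eq]
  have hcurl : curl (reflField 1 0 u) y = -axisRefl (cosTwo y) (sinTwo y) (curl u y) := by
    have := curl_reflField (hu.differentiable (by norm_num)) hc y
    rw [axisRefl_self hy] at this
    rw [← this]
    simp only [curl, hpd]
  have hlin : curl (symPart ε u) y = (2⁻¹ : ℝ) • (curl u y + ε • curl (reflField 1 0 u) y) := by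
    ext i
    fin_cases i <;> simp [curl, pd_symPart hu] <;> ring
  rw [hlin, hcurl, smul_neg, sub_eq_add_neg]

lemma norm_curl_symPart_le (hu : ContDiff ℝ 1 u) (hax : IsAxisymmetric u) {ε : ℝ} (hε : |ε| = 1)
    {y : E3} (hy : 0 < rad y) : ‖curl (symPart ε u) y‖ ≤ ‖curl u y‖ := by
  rw [curl_symPart hu hax ε hy, norm_smul]
  have h := norm_sub_le (curl u y) (ε • axisRefl (cosTwo y) (sinTwo y) (curl u y))
  rw [norm_smul, norm_axisRefl (cosTwo_sq_add_sinTwo_sq hy), Real.norm_eq_abs, hε] at h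
  norm_num
  linarith

/-- Each entry obeys (a - b)² ≤ 2a² + 2b², and the diagonal derivatives are added for free. -/
lemma norm_curl_sq_le (u : E3 → E3) (y : E3) : ‖curl u y‖ ^ 2 ≤ 2 * ∑ j, ‖pd j u y‖ ^ 2 := by
  simp only [EuclideanSpace.norm_sq_eq, Fin.sum_univ_three, curl, Real.norm_eq_abs, sq_abs,
    Matrix.cons_val_zero, Matrix.cons_val_one, Matrix.cons_val]
  nlinarith [sq_nonneg (pd 1 u y 2 + pd 2 u y 1), sq_nonneg (pd 2 u y 0 + pd 0 u y 2),
    sq_nonneg (pd 0 u y 1 + pd 1 u y 0), sq_nonneg (pd 0 u y 0), sq_nonneg (pd 1 u y 1),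
    sq_nonneg (pd 2 u y 2)]

lemma lintegral_curl_symPart_le (hu : ContDiff ℝ 1 u) (hax : IsAxisymmetric u) {ε : ℝ}
    (hε : |ε| = 1) {D : ℝ≥0} (hD : dirichletEnergy u ≤ D) :
    ∫⁻ y, ENNReal.ofReal (‖curl (symPart ε u) y‖ ^ 2) ≤ ENNReal.ofReal (2 * D) := by
  calc _ ≤ ∫⁻ y, ENNReal.ofReal 2 * ENNReal.ofReal (∑ j, ‖pd j u y‖ ^ 2) := by
        refine lintegral_mono_ae ?_
        filter_upwards [ae_rad_pos] with y hy
        rw [← ENNReal.ofReal_mul (by norm_num)]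
        apply ENNReal.ofReal_le_ofReal
        refine le_trans ?_ (norm_curl_sq_le u y)
        have := norm_curl_symPart_le hu hax hε hy
        gcongr
    _ = ENNReal.ofReal 2 * dirichletEnergy u := lintegral_const_mul' _ _ ENNReal.ofReal_ne_top
    _ ≤ ENNReal.ofReal 2 * D := by gcongr
    _ = _ := by rw [ENNReal.ofReal_mul (by norm_num), ENNReal.ofReal_coe_nnreal]

end SymPart

end AxiNS

/-! ### Conclusion for the cylindrical components. -/

theorem proposition4p1 (β : ℝ) (hβ : 1 < β) (C₀ : ℝ) (D : ℝ≥0) :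
    ∃ C : ℝ, ∀ (u : AxiNS.E3 → AxiNS.E3) (p : AxiNS.E3 → ℝ),
      AxiNS.IsAxisymmetricSolution u p → AxiNS.dirichletEnergy u ≤ (D : ℝ≥0∞) →
      ((∀ x, 0 < AxiNS.rad x →
          |AxiNS.compθ (AxiNS.curl u) x| ≤ C₀ * AxiNS.rad x ^ (-β)) →
        ∀ x, 1 < AxiNS.rad x →
          |AxiNS.compR u x| + |AxiNS.compZ u x| ≤ C * AxiNS.decayRate β (AxiNS.rad x)) ∧
      ((∀ x, 0 < AxiNS.rad x →
          |AxiNS.compR (AxiNS.curl u) x| + |AxiNS.compZ (AxiNS.curl u) x|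
            ≤ C₀ * AxiNS.rad x ^ (-β)) →
        ∀ x, 1 < AxiNS.rad x →
          |AxiNS.compθ u x| ≤ C * AxiNS.decayRate β (AxiNS.rad x)) := by
  open AxiNS in
  -- `C₀` may be negative, hence the absolute value; the energy bound is doubled because |curl u|² ≤
  -- 2|∇u|².
  obtain ⟨C, hC⟩ := norm_le_decayRate_of_curl (β := β) (C₀ := |C₀|) (D := 2 * D) hβ (abs_nonneg _)
    (by positivity)
  have hC₀ : ∀ y : E3, 0 < rad y → C₀ * rad y ^ (-β) ≤ |C₀| * rad y ^ (-β) := fun y hy =>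
    mul_le_mul_of_nonneg_right (le_abs_self _) (Real.rpow_nonneg hy.le _)
  -- The factor 2 pays for the sum |u_r| + |u_z|, each term being at most the norm of the meridional
  -- part.
  refine ⟨2 * C, fun u p hsol hD => ?_⟩
  have hu : ContDiff ℝ 1 u := hsol.smooth_velocity.of_le (by simp)
  have hax := hsol.axisymmetric
  have hdecay : ∀ ε : ℝ, |ε| = 1 → (∀ y, 0 < rad y →
      ‖curl (symPart ε u) y‖ ≤ |C₀| * rad y ^ (-β)) → ∀ x, 1 < rad x →
      ‖symPart ε u x‖ ≤ C * decayRate β (rad x) := fun ε hε hw =>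
    hC _ (contDiff_symPart hu ε) (divergence_symPart hu hsol.incompressible ε)
      (tendsto_symPart hsol.vanishing ε) hw (lintegral_curl_symPart_le hu hax hε hD)
  constructor
  · intro hw x hx
    have hx0 : 0 < rad x := by linarith
    have h := hdecay 1 (by simp) (fun y hy => by
      rw [curl_symPart hu hax _ hy, one_smul, half_sub_axisRefl hy, norm_smul, norm_eθ hy, mul_one]
      exact (hw y hy).trans (hC₀ y hy)) x hx
    have hs := symPart_eq hax 1 hx0
    rw [one_smul, half_add_axisRefl hx0] at hs
    have hR : |compR u x| ≤ ‖symPart 1 u x‖ := by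
      have h1 := abs_real_inner_le_norm (symPart 1 u x) (er x)
      rw [norm_er hx0, mul_one] at h1
      have h2 : inner ℝ (symPart 1 u x) (er x) = compR u x := by
        rw [hs, inner_add_left, real_inner_smul_left, real_inner_smul_left,
          real_inner_self_eq_norm_sq, norm_er hx0]
        simp [ez, er, PiLp.inner_apply, Fin.sum_univ_three]
      rwa [h2] at h1
    have hZ : |compZ u x| ≤ ‖symPart 1 u x‖ := by
      have h1 := abs_real_inner_le_norm (symPart 1 u x) ez
      rw [norm_ez, mul_one] at h1
      have h2 : inner ℝ (symPart 1 u x) ez = compZ u x := by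
        rw [hs, inner_add_left, real_inner_smul_left, real_inner_smul_left,
          real_inner_self_eq_norm_sq, norm_ez]
        simp [ez, er, PiLp.inner_apply, Fin.sum_univ_three]
      rwa [h2] at h1
    linarith
  · intro hw x hx
    have hx0 : 0 < rad x := by linarith
    have h := hdecay (-1) (by simp) (fun y hy => by
      rw [curl_symPart hu hax _ hy, neg_smul, one_smul, sub_neg_eq_add, half_add_axisRefl hy]
      refine (norm_add_le _ _).trans ?_
      rw [norm_smul, norm_smul, norm_er hy, norm_ez, mul_one, mul_one]
      exact (hw y hy).trans (hC₀ y hy)) x hx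
    have hs := symPart_eq hax (-1) hx0
    rw [neg_smul, one_smul, ← sub_eq_add_neg, half_sub_axisRefl hx0] at hs
    have hn : ‖symPart (-1) u x‖ = |compθ u x| := by
      rw [hs, norm_smul, norm_eθ hx0, mul_one, Real.norm_eq_abs]
    rw [hn] at h
    linarith [abs_nonneg (compθ u x)]
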